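/- Let $S$ be a separated noetherian scheme, and let $Sm_S$ be the category of smooth separated $S$-schemes of finite type. Let $Cor$ be a ringoid over $S$: an additive category together with a functor $\gamma\colon Sm_S\to Cor$ that is the identity (a bijection) on objects and takes finite disjoint unions to direct sums. Let $Pre$ be the category of presheaves of abelian groups $F$ on $Sm_S$ that are additive, i.e. take finite disjoint unions to finite direct sums ($F(\emptyset)=0$ and $F(X_1\amalg X_2)=F(X_1)\oplus F(X_2)$), and let $Pre(Cor)$ be the category of additive functors $Cor^{op}\to Ab$. Restriction along $\gamma$ is a functor $F_{tr}\colon Pre(Cor)\to Pre$; let $L_{tr}\colon Pre\to Pre(Cor)$ be its left adjoint, the additive left Kan extension along $\gamma$. For a point $x$ of $X\in Sm_S$ regard the henselian local scheme $X^h_x$ as the pro-object of all Nisnevich neighbourhoods of $x$, i.e. étale morphisms $V\to X$ in $Sm_S$ with a lift of $\operatorname{Spec}\kappa(x)\to X$ to $V$. For $U=Y^h_y$ put $Cor(U,X)=\varinjlim_W Cor(W,X)$ and $Cor(U,X^h_x)=\varprojlim_V\varinjlim_W Cor(W,V)$, where $W$ runs over the Nisnevich neighbourhoods of $y$ in $Y$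 and $V$ over those of $x$ in $X$. Assume condition (NL): for all $X,Y\in Sm_S$ and every point $y\in Y$, with $U=Y^h_y$, the canonical homomorphism $$\bigoplus_{x\in X} Cor(U,X^h_x)\longrightarrow Cor(U,X),$$ where $x$ runs over all points of the scheme $X$, is an isomorphism. Call an object $A$ of $D^-(Pre)$ (of $D^-(Pre(Cor))$) Nisnevich acyclic if for all $i\in\mathbb Z$ the Nisnevich sheaf on $Sm_S$ associated with the cohomology presheaf $h^i(A)$ (with $F_{tr}h^i(A)$) is zero, and call a morphism a Nisnevich quasi-isomorphism if it induces isomorphisms on all these sheaves. Then the total left derived functor $\mathcal L_{tr}\colon D^-(Pre)\to D^-(Pre(Cor))$ of $L_{tr}$ exists, it takes Nisnevich acyclic objects to Nisnevich acyclic objects, and it takes Nisnevich quasi-isomorphisms to Nisnevich quasi-isomorphisms. -/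

import Mathlib

open CategoryTheory Limits Opposite AlgebraicGeometry

universe w₁ w₂ u

noncomputable section

namespace NisTransfer

open scoped ZeroObject

/-! ### Smooth schemes and the Nisnevich topology -/

/-- Smooth separated morphisms of finite type. -/
def smoothProperty : MorphismProperty Scheme.{u} :=
  fun _ _ f => Smooth f ∧ IsSeparated f ∧ QuasiCompact f

/-- The category `Sm_S` of smooth separated `S`-schemes of finite type. -/
abbrev Sm (S : Scheme.{u}) : Type (u + 1) := smoothProperty.{u}.Over ⊤ S

variable {S : Scheme.{u}}

/-- `f : V ⟶ X` is a Nisnevich neighbourhood of the point `x` of `X`: it is étale, and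
`Spec κ(x) ⟶ X` lifts to `V` (i.e. some point of `V` over `x` has the same residue field). -/
def IsNisnevichAt {V X : Sm S} (f : V ⟶ X) (x : X.left) : Prop :=
  Etale f.left ∧ ∃ s : Spec (X.left.residueField x) ⟶ V.left,
    s ≫ f.left = X.left.fromSpecResidueField x


lemma Sm.isSeparated_left {V X : Sm S} (f : V ⟶ X) : IsSeparated f.left := by
  have h : f.left ≫ X.hom = V.hom := CategoryTheory.Over.w f.hom
  have : IsSeparated (f.left ≫ X.hom) := by rw [h]; exact V.prop.2.1
  exact IsSeparated.of_comp f.left X.hom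

lemma Sm.quasiCompact_left {V X : Sm S} (f : V ⟶ X) : QuasiCompact f.left := by
  have h : f.left ≫ X.hom = V.hom := CategoryTheory.Over.w f.hom
  have : QuasiCompact (f.left ≫ X.hom) := by rw [h]; exact V.prop.2.2
  have : IsSeparated X.hom := X.prop.2.1
  exact QuasiCompact.of_comp f.left X.hom

lemma exists_fac_fromSpecResidueField {K : Type u} [Field K] {V : Scheme.{u}}
    (s : Spec (.of K) ⟶ V) : ∃ (v : V) (t : Spec (.of K) ⟶ Spec (V.residueField v)),
      t ≫ V.fromSpecResidueField v = s :=
  ⟨_, _, Scheme.descResidueField_stalkClosedPointTo_fromSpecResidueField K V s⟩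

/-- The Nisnevich topology on `Sm_S`: a sieve on `X` is covering iff it contains, for every point
`x` of `X`, a Nisnevich neighbourhood of `x`. -/
def nisTopology (S : Scheme.{u}) : GrothendieckTopology (Sm S) where
  sieves X := {R | ∀ x : X.left, ∃ (V : Sm S) (f : V ⟶ X), R f ∧ IsNisnevichAt f x}
  top_mem' X x := ⟨X, 𝟙 X, trivial, by
    refine ⟨?_, X.left.fromSpecResidueField x, ?_⟩
    · change Etale (𝟙 X.left); infer_instance
    · change _ ≫ 𝟙 X.left = _; simp⟩
  pullback_stable' := by
    intro X Y R g hR y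
    obtain ⟨V, f, hf, het, s, hs⟩ := hR (g.left y)
    have := Sm.isSeparated_left f
    have := Sm.quasiCompact_left f
    have hY : Smooth Y.hom := Y.prop.1
    have hY' : IsSeparated Y.hom := Y.prop.2.1
    have hY'' : QuasiCompact Y.hom := Y.prop.2.2
    let P : Sm S := MorphismProperty.Over.mk ⊤ (pullback.snd f.left g.left ≫ Y.hom)
      ⟨inferInstance, inferInstance, inferInstance⟩
    let p : P ⟶ Y := MorphismProperty.Over.homMk (pullback.snd f.left g.left) rfl trivial
    let q : P ⟶ V := MorphismProperty.Over.homMk (pullback.fst f.left g.left) (by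
      change pullback.fst f.left g.left ≫ V.hom = pullback.snd f.left g.left ≫ Y.hom
      have h1 : f.left ≫ X.hom = V.hom := CategoryTheory.Over.w f.hom
      have h2 : g.left ≫ X.hom = Y.hom := CategoryTheory.Over.w g.hom
      rw [← h1, ← h2, pullback.condition_assoc]) trivial
    have hqp : p ≫ g = q ≫ f := by
      ext
      exact (pullback.condition (f := f.left) (g := g.left)).symm
    refine ⟨P, p, ?_, ?_, pullback.lift (Spec.map (g.left.residueFieldMap y) ≫ s)
      (Y.left.fromSpecResidueField y) ?_, ?_⟩
    · change R (p ≫ g)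
      rw [hqp]
      exact R.downward_closed hf q
    · change Etale (pullback.snd f.left g.left)
      infer_instance
    · rw [Category.assoc, hs, Scheme.Hom.SpecMap_residueFieldMap_fromSpecResidueField]
    · exact pullback.lift_snd _ _ _
  transitive' := by
    intro X R hR R' hR' x
    obtain ⟨V, f, hf, het, s, hs⟩ := hR x
    obtain ⟨v, r, hr⟩ := exists_fac_fromSpecResidueField (K := X.left.residueField x) s
    obtain ⟨W, g, hg, het', t, ht⟩ := hR' hf v
    refine ⟨W, g ≫ f, hg, ?_, r ≫ t, ?_⟩
    · change Etale (g.left ≫ f.left)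
      infer_instance
    · change _ ≫ g.left ≫ f.left = _
      rw [Category.assoc, reassoc_of% ht, reassoc_of% hr]
      exact hs

/-! ### Nisnevich neighbourhoods and henselizations as pro-objects -/

/-- A Nisnevich neighbourhood of a point `x` of `X` in `Sm_S`: an étale `X`-scheme together with a
lift of `Spec κ(x) ⟶ X`. -/
structure NisNbhd (X : Sm S) (x : X.left) where
  V : Sm S
  f : V ⟶ X
  etale : Etale f.left
  s : Spec (X.left.residueField x) ⟶ V.left
  fac : s ≫ f.left = X.left.fromSpecResidueField x

namespace NisNbhd

variable {X : Sm S} {x : X.left}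

/-- Morphisms of neighbourhoods: `X`-morphisms that are compatible with the lifts. -/
@[ext]
structure Hom (A B : NisNbhd X x) where
  g : A.V ⟶ B.V
  w : g ≫ B.f = A.f
  w' : A.s ≫ g.left = B.s

instance : Category (NisNbhd X x) where
  Hom := Hom
  id A := ⟨𝟙 A.V, by simp, by change _ ≫ 𝟙 _ = _; simp⟩
  comp a b := ⟨a.g ≫ b.g, by rw [Category.assoc, b.w, a.w], by
    change _ ≫ a.g.left ≫ b.g.left = _
    rw [← Category.assoc, a.w', b.w']⟩
  id_comp _ := Hom.ext (Category.id_comp _)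
  comp_id _ := Hom.ext (Category.comp_id _)
  assoc _ _ _ := Hom.ext (Category.assoc _ _ _)

/-- The henselian local scheme `X_x^h`, as a pro-object of `Sm_S`: the cofiltered diagram of all
Nisnevich neighbourhoods of `x`. -/
def pro (X : Sm S) (x : X.left) : NisNbhd X x ⥤ Sm S where
  obj A := A.V
  map a := a.g
  map_id _ := rfl
  map_comp _ _ := rfl

/-- `X` as a neighbourhood of `x`. -/
def self (X : Sm S) (x : X.left) : NisNbhd X x where
  V := X
  f := 𝟙 X
  etale := by change Etale (𝟙 X.left); infer_instance
  s := X.left.fromSpecResidueField x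
  fac := by change _ ≫ 𝟙 X.left = _; simp

end NisNbhd


/-! ### Presheaves, presheaves with transfers -/

/-- The additivity condition `F(∅) = 0`, `F(X₁ ⨿ X₂) = F(X₁) ⊕ F(X₂)` on a presheaf of abelian
groups on `Sm_S`, i.e. finite coproducts of schemes are sent to products. -/
def additivePresheaf (S : Scheme.{u}) : ObjectProperty ((Sm S)ᵒᵖ ⥤ AddCommGrpCat.{u + 1}) :=
  fun F => PreservesFiniteProducts F

/-- The category `Pre` of (additive) presheaves of abelian groups on `Sm_S`. -/
abbrev Pre (S : Scheme.{u}) := (additivePresheaf S).FullSubcategory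

lemma preservesFiniteProducts_flip {C K : Type*} [Category* C] [Category* K]
    {D : K ⥤ C ⥤ AddCommGrpCat.{u + 1}} (hD : ∀ k, PreservesFiniteProducts (D.obj k)) :
    PreservesFiniteProducts D.flip :=
  ⟨fun _ => ⟨⟨fun {_} hs => ⟨evaluationJointlyReflectsLimits _
    (fun k => isLimitOfPreserves (D.obj k) hs)⟩⟩⟩⟩

lemma preservesFiniteProducts_of_isLimit {C K : Type*} [Category* C] [Category* K]
    [HasLimitsOfShape K AddCommGrpCat.{u + 1}]
    {D : K ⥤ C ⥤ AddCommGrpCat.{u + 1}} {c : Cone D} (hc : IsLimit c)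
    (hD : ∀ k, PreservesFiniteProducts (D.obj k)) : PreservesFiniteProducts c.pt := by
  have := preservesFiniteProducts_flip hD
  have : PreservesLimits (lim : (K ⥤ AddCommGrpCat.{u + 1}) ⥤ _) :=
    constLimAdj.rightAdjoint_preservesLimits
  let e : D.flip ⋙ lim ≅ c.pt := NatIso.ofComponents
    (fun j => (limit.isLimit (D.flip.obj j)).conePointUniqueUpToIso
      (isLimitOfPreserves ((evaluation _ _).obj j) hc))
    (fun {i j} f => by
      rw [← Iso.inv_comp_eq, ← Category.assoc, ← Iso.eq_comp_inv]
      apply limit.hom_ext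
      intro k
      have h1 := (limit.isLimit (D.flip.obj i)).conePointUniqueUpToIso_inv_comp
        (isLimitOfPreserves ((evaluation _ _).obj i) hc) k
      have h2 := (limit.isLimit (D.flip.obj j)).conePointUniqueUpToIso_inv_comp
        (isLimitOfPreserves ((evaluation _ _).obj j) hc) k
      dsimp at h1 h2 ⊢
      simp [h2, reassoc_of% h1])
  have : PreservesFiniteProducts (D.flip ⋙ lim) := comp_preservesFiniteProducts _ _
  exact ⟨fun n => preservesLimitsOfShape_of_natIso e⟩

lemma preservesFiniteProducts_of_isColimit {C K : Type*} [Category* C] [Category* K]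
    [HasColimitsOfShape K AddCommGrpCat.{u + 1}]
    {D : K ⥤ C ⥤ AddCommGrpCat.{u + 1}} {c : Cocone D} (hc : IsColimit c)
    (hD : ∀ k, PreservesFiniteProducts (D.obj k)) : PreservesFiniteProducts c.pt := by
  have := preservesFiniteProducts_flip hD
  have : (colim : (K ⥤ AddCommGrpCat.{u + 1}) ⥤ _).Additive :=
    { map_add := by
        intro X Y f g
        apply colimit.hom_ext
        intro j
        simp }
  let e : D.flip ⋙ colim ≅ c.pt := NatIso.ofComponents
    (fun j => (colimit.isColimit (D.flip.obj j)).coconePointUniqueUpToIso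
      (isColimitOfPreserves ((evaluation _ _).obj j) hc))
    (fun {i j} f => by
      apply colimit.hom_ext
      intro k
      have h1 := (colimit.isColimit (D.flip.obj i)).comp_coconePointUniqueUpToIso_hom
        (isColimitOfPreserves ((evaluation _ _).obj i) hc) k
      have h2 := (colimit.isColimit (D.flip.obj j)).comp_coconePointUniqueUpToIso_hom
        (isColimitOfPreserves ((evaluation _ _).obj j) hc) k
      dsimp at h1 h2 ⊢
      simp [h2, reassoc_of% h1])
  have : PreservesFiniteProducts (D.flip ⋙ colim) := comp_preservesFiniteProducts _ _
  exact ⟨fun n => preservesLimitsOfShape_of_natIso e⟩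

instance : (additivePresheaf S).IsClosedUnderFiniteProducts where
  isClosedUnderLimitsOfShape J _ := ⟨by
    rintro F ⟨h⟩
    exact preservesFiniteProducts_of_isLimit h.isLimit h.prop_diag_obj⟩

instance : (additivePresheaf S).IsClosedUnderKernels where
  kernels_le := by
    rintro _ ⟨f, k, hk, hX, hY⟩
    exact preservesFiniteProducts_of_isLimit hk (by rintro (_ | _) <;> assumption)

instance : (additivePresheaf S).IsClosedUnderCokernels where
  cokernels_le := by
    rintro _ ⟨f, k, hk, hX, hY⟩
    exact preservesFiniteProducts_of_isColimit hk (by rintro (_ | _) <;> assumption)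

instance : (additivePresheaf S).IsClosedUnderIsomorphisms where
  of_iso e h := by
    have : PreservesFiniteProducts _ := h
    exact ⟨fun n => preservesLimitsOfShape_of_natIso e⟩

instance : (additivePresheaf S).ContainsZero where
  exists_zero := ⟨_, (isZero_zero ((Sm S)ᵒᵖ ⥤ AddCommGrpCat.{u + 1})),
    ObjectProperty.prop_of_isLimit (J := Discrete PEmpty.{1}) _ (F := Functor.empty _)
      (c := ⟨0, ⟨fun i => i.as.elim, by rintro ⟨⟨⟩⟩⟩⟩)
      { lift := fun _ => 0
        fac := by rintro _ ⟨⟨⟩⟩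
        uniq := fun _ _ _ => (isZero_zero _).eq_of_tgt _ _ } (by rintro ⟨⟨⟩⟩)⟩

instance : Abelian (Pre S) := inferInstance

/-- The category `Pre(Cor)` of presheaves with transfers: additive functors from `Cor` (with
reversed arrows) to abelian groups. -/
abbrev PreTr (Cor : Type (u + 1)) [Category.{u} Cor] [Preadditive Cor] :=
  Corᵒᵖ ⥤+ AddCommGrpCat.{u + 1}

section

variable {Cor : Type (u + 1)} [Category.{u} Cor] [Preadditive Cor]

instance : (additiveFunctor Corᵒᵖ AddCommGrpCat.{u + 1}).IsClosedUnderSubobjects where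
  prop_of_mono {F G} i _ hG := by
    have : G.Additive := hG
    refine ⟨fun {X Y f g} => ?_⟩
    rw [← cancel_mono (i.app Y)]
    simp

instance : (additiveFunctor Corᵒᵖ AddCommGrpCat.{u + 1}).IsClosedUnderQuotients where
  prop_of_epi {F G} p _ hF := by
    have : F.Additive := hF
    refine ⟨fun {X Y f g} => ?_⟩
    rw [← cancel_epi (p.app X)]
    simp [← NatTrans.naturality]

instance : (additiveFunctor Corᵒᵖ AddCommGrpCat.{u + 1}).ContainsZero where
  exists_zero := ⟨0, isZero_zero _, (inferInstance : (0 : Corᵒᵖ ⥤ AddCommGrpCat).Additive)⟩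

instance : (additiveFunctor Corᵒᵖ AddCommGrpCat.{u + 1}).IsClosedUnderFiniteProducts where
  isClosedUnderLimitsOfShape J _ := ⟨by
    rintro F ⟨h⟩
    refine ⟨fun {X Y f g} => ?_⟩
    refine (isLimitOfPreserves ((evaluation _ _).obj Y) h.isLimit).hom_ext fun j => ?_
    have : (h.diag.obj j).Additive := h.prop_diag_obj j
    simp⟩

instance : Abelian (PreTr Cor) := inferInstance

end

/-! ### The transfer functor -/

section transfer

variable {Cor : Type (u + 1)} [Category.{u} Cor] [Preadditive Cor] (γ : Sm S ⥤ Cor)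

/-- The forgetful functor `F_tr : Pre(Cor) ⥤ Pre`, the restriction along `γ : Sm_S ⥤ Cor`. -/
def forgetTr [PreservesFiniteCoproducts γ] : PreTr Cor ⥤ Pre S :=
  (additivePresheaf S).lift (AdditiveFunctor.forget _ _ ⋙ (Functor.whiskeringLeft _ _ _).obj γ.op)
    (fun G => by
      have : PreservesFiniteProducts γ.op := preservesFiniteProducts_op γ
      exact comp_preservesFiniteProducts γ.op G.obj)

instance [PreservesFiniteCoproducts γ] : (forgetTr γ).Additive where
  map_add := rfl

/-- Generators of the value at `c` of the left Kan extension: symbols `a ⊗ φ` with `a ∈ F(X)` and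
`φ ∈ Cor(c, X)`. -/
abbrev KanGen (F : Pre S) (c : Cor) := Σ X : Sm S, F.obj.obj (op X) × (c ⟶ γ.obj X)

variable {γ} in
/-- The symbol `a ⊗ φ` in the free abelian group. -/
def kanSymbol {F : Pre S} {c : Cor} {X : Sm S} (a : F.obj.obj (op X)) (φ : c ⟶ γ.obj X) :
    FreeAbelianGroup (KanGen γ F c) :=
  FreeAbelianGroup.of ⟨X, a, φ⟩

/-- The relations: `a ⊗ φ` is biadditive, and `f^* a ⊗ φ = a ⊗ (γ(f) ∘ φ)`. -/
inductive KanRel (F : Pre S) (c : Cor) : FreeAbelianGroup (KanGen γ F c) → Prop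
  | add_left {X : Sm S} (a b : F.obj.obj (op X)) (φ : c ⟶ γ.obj X) :
      KanRel F c (kanSymbol (a + b) φ - (kanSymbol a φ + kanSymbol b φ))
  | add_right {X : Sm S} (a : F.obj.obj (op X)) (φ ψ : c ⟶ γ.obj X) :
      KanRel F c (kanSymbol a (φ + ψ) - (kanSymbol a φ + kanSymbol a ψ))
  | balance {X Y : Sm S} (f : X ⟶ Y) (a : F.obj.obj (op Y)) (φ : c ⟶ γ.obj X) :
      KanRel F c (kanSymbol (F.obj.map f.op a) φ - kanSymbol a (φ ≫ γ.map f))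

/-- The value at `c` of the additive left Kan extension of `F` along `γ`, i.e. the coend
`∫^X F(X) ⊗ Cor(c, γ X)`. -/
abbrev KanValue (F : Pre S) (c : Cor) : Type (u + 1) :=
  FreeAbelianGroup (KanGen γ F c) ⧸ AddSubgroup.closure {z | KanRel γ F c z}

variable {γ} in
/-- The class of `a ⊗ φ`. -/
def kanMk {F : Pre S} {c : Cor} {X : Sm S} (a : F.obj.obj (op X)) (φ : c ⟶ γ.obj X) :
    KanValue γ F c :=
  QuotientAddGroup.mk (kanSymbol a φ)

lemma kanMk_eq_of_rel {F : Pre S} {c : Cor} {z w : FreeAbelianGroup (KanGen γ F c)}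
    (h : KanRel γ F c (z - w)) :
    (QuotientAddGroup.mk z : KanValue γ F c) = QuotientAddGroup.mk w := by
  rw [eq_comm, QuotientAddGroup.eq, neg_add_eq_sub]
  exact AddSubgroup.subset_closure h

variable {γ} in
lemma kanMk_add_left {F : Pre S} {c : Cor} {X : Sm S} (a b : F.obj.obj (op X))
    (φ : c ⟶ γ.obj X) : kanMk (a + b) φ = kanMk a φ + kanMk b φ :=
  kanMk_eq_of_rel γ (.add_left a b φ)

variable {γ} in
lemma kanMk_add_right {F : Pre S} {c : Cor} {X : Sm S} (a : F.obj.obj (op X))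
    (φ ψ : c ⟶ γ.obj X) : kanMk a (φ + ψ) = kanMk a φ + kanMk a ψ :=
  kanMk_eq_of_rel γ (.add_right a φ ψ)

variable {γ} in
lemma kanMk_balance {F : Pre S} {c : Cor} {X Y : Sm S} (f : X ⟶ Y) (a : F.obj.obj (op Y))
    (φ : c ⟶ γ.obj X) : kanMk (F.obj.map f.op a) φ = kanMk a (φ ≫ γ.map f) :=
  kanMk_eq_of_rel γ (.balance f a φ)

variable {γ} in
/-- Homomorphisms out of `KanValue`. -/
def kanLift {F : Pre S} {c : Cor} {A : Type*} [AddCommGroup A]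
    (t : ∀ X : Sm S, F.obj.obj (op X) → (c ⟶ γ.obj X) → A)
    (h₁ : ∀ X a b φ, t X (a + b) φ = t X a φ + t X b φ)
    (h₂ : ∀ X a φ ψ, t X a (φ + ψ) = t X a φ + t X a ψ)
    (h₃ : ∀ (X Y : Sm S) (f : X ⟶ Y) a φ, t X (F.obj.map f.op a) φ = t Y a (φ ≫ γ.map f)) :
    KanValue γ F c →+ A :=
  QuotientAddGroup.lift _ (FreeAbelianGroup.lift fun g => t g.1 g.2.1 g.2.2) (by
    rw [AddSubgroup.closure_le]
    rintro _ (⟨a, b, φ⟩ | ⟨a, φ, ψ⟩ | ⟨f, a, φ⟩)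
    · simp [kanSymbol, h₁]
    · simp [kanSymbol, h₂]
    · simp [kanSymbol, h₃])

variable {γ} in
@[simp]
lemma kanLift_mk {F : Pre S} {c : Cor} {A : Type*} [AddCommGroup A]
    (t : ∀ X : Sm S, F.obj.obj (op X) → (c ⟶ γ.obj X) → A) (h₁ h₂ h₃)
    {X : Sm S} (a : F.obj.obj (op X)) (φ : c ⟶ γ.obj X) :
    kanLift t h₁ h₂ h₃ (kanMk a φ) = t X a φ := by
  change FreeAbelianGroup.lift _ (FreeAbelianGroup.of _) = _
  simp

variable {γ} in
lemma kan_hom_ext {F : Pre S} {c : Cor} {A : Type*} [AddCommGroup A]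
    {f g : KanValue γ F c →+ A}
    (h : ∀ (X : Sm S) (a : F.obj.obj (op X)) (φ : c ⟶ γ.obj X),
      f (kanMk a φ) = g (kanMk a φ)) : f = g := by
  apply QuotientAddGroup.addMonoidHom_ext
  apply FreeAbelianGroup.lift_ext
  rintro ⟨X, a, φ⟩
  exact h X a φ

/-- Functoriality of `KanValue` in `c`. -/
def kanMap (F : Pre S) {c c' : Cor} (g : c' ⟶ c) : KanValue γ F c →+ KanValue γ F c' :=
  kanLift (fun _ a φ => kanMk a (g ≫ φ)) (fun _ _ _ _ => kanMk_add_left _ _ _)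
    (fun _ _ _ _ => by rw [Preadditive.comp_add, kanMk_add_right])
    (fun _ _ _ _ _ => by rw [kanMk_balance, Category.assoc])

@[simp]
lemma kanMap_mk (F : Pre S) {c c' : Cor} (g : c' ⟶ c) {X : Sm S} (a : F.obj.obj (op X))
    (φ : c ⟶ γ.obj X) : kanMap γ F g (kanMk a φ) = kanMk a (g ≫ φ) :=
  kanLift_mk _ _ _ _ _ _

/-- The additive left Kan extension of `F` along `γ`. -/
def transferObj (F : Pre S) : PreTr Cor where
  obj :=
    { obj := fun c => AddCommGrpCat.of (KanValue γ F c.unop)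
      map := fun g => AddCommGrpCat.ofHom (kanMap γ F g.unop)
      map_id := fun c => by
        ext1
        exact kan_hom_ext fun X a φ => by simp
      map_comp := fun g h => by
        ext1
        exact kan_hom_ext fun X a φ => by simp }
  property := by
    refine ⟨fun {c c' g h} => ?_⟩
    ext1
    exact kan_hom_ext fun X a φ => by
      simp [Preadditive.add_comp, kanMk_add_right]

lemma transferObj_hom_ext {F : Pre S} {G : PreTr Cor} {θ θ' : transferObj γ F ⟶ G}
    (h : ∀ (c : Cor) (X : Sm S) (a : F.obj.obj (op X)) (φ : c ⟶ γ.obj X),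
      θ.hom.app (op c) (kanMk a φ : KanValue γ F c) =
        θ'.hom.app (op c) (kanMk a φ : KanValue γ F c)) : θ = θ' := by
  apply ObjectProperty.hom_ext
  ext1
  funext c
  ext1
  exact kan_hom_ext fun X a φ => h c.unop X a φ

variable [PreservesFiniteCoproducts γ]

/-- The morphism `F ⟶ F_tr(G)` corresponding to `L_tr(F) ⟶ G`. -/
def ofTransfer (F : Pre S) (G : PreTr Cor) (θ : transferObj γ F ⟶ G) :
    F ⟶ (forgetTr γ).obj G :=
  ObjectProperty.homMk
    { app := fun X => AddCommGrpCat.ofHom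
        (AddMonoidHom.mk' (fun a => θ.hom.app (op (γ.obj X.unop))
            (kanMk a (𝟙 _) : KanValue γ F (γ.obj X.unop)))
          (fun a b => by rw [kanMk_add_left]; exact map_add (θ.hom.app _).hom _ _))
      naturality := fun X Y f => by
        ext a
        have h := ConcreteCategory.congr_hom (θ.hom.naturality (γ.map f.unop).op)
          (kanMk a (𝟙 _) : KanValue γ F (γ.obj X.unop))
        change θ.hom.app _ (kanMap γ F (γ.map f.unop) (kanMk a (𝟙 _))) = _ at h
        rw [kanMap_mk, Category.comp_id] at h
        change θ.hom.app _ (kanMk (F.obj.map f.unop.op a) (𝟙 _)) = _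
        rw [kanMk_balance, Category.id_comp]
        exact h }

/-- The components `a ⊗ φ ↦ φ^* η(a)` of the morphism `L_tr(F) ⟶ G` corresponding to
`η : F ⟶ F_tr(G)`. -/
def toTransferApp (F : Pre S) (G : PreTr Cor) (η : F ⟶ (forgetTr γ).obj G) (c : Cor) :
    KanValue γ F c →+ G.obj.obj (op c) :=
  kanLift (fun X a φ => G.obj.map φ.op (η.hom.app (op X) a))
    (fun X a b φ => by
      rw [map_add]
      exact map_add (G.obj.map φ.op).hom _ _)
    (fun X a φ ψ => by rw [op_add, Functor.map_add]; rfl)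
    (fun X Y f a φ => by
      have h := ConcreteCategory.congr_hom (η.hom.naturality f.op) a
      change η.hom.app _ (F.obj.map f.op a) =
        G.obj.map (γ.map f).op (η.hom.app (op Y) a) at h
      rw [h, op_comp, Functor.map_comp]; rfl)

lemma toTransferApp_mk (F : Pre S) (G : PreTr Cor) (η : F ⟶ (forgetTr γ).obj G) (c : Cor)
    (X : Sm S) (a : F.obj.obj (op X)) (φ : c ⟶ γ.obj X) :
    toTransferApp γ F G η c (kanMk a φ) = G.obj.map φ.op (η.hom.app (op X) a) :=
  kanLift_mk _ _ _ _ _ _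

/-- The morphism `L_tr(F) ⟶ G` corresponding to `F ⟶ F_tr(G)`. -/
def toTransfer (F : Pre S) (G : PreTr Cor) (η : F ⟶ (forgetTr γ).obj G) :
    transferObj γ F ⟶ G :=
  ObjectProperty.homMk
    { app := fun c => AddCommGrpCat.ofHom (toTransferApp γ F G η c.unop)
      naturality := fun c c' g => by
        ext1
        refine kan_hom_ext fun X a φ => ?_
        change toTransferApp γ F G η c'.unop (kanMap γ F g.unop (kanMk a φ)) =
          G.obj.map g (toTransferApp γ F G η c.unop (kanMk a φ))
        rw [kanMap_mk, toTransferApp_mk, toTransferApp_mk, op_comp, Functor.map_comp]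
        rfl }

lemma ofTransfer_app (F : Pre S) (G : PreTr Cor) (θ : transferObj γ F ⟶ G) (X : Sm S)
    (a : F.obj.obj (op X)) :
    (ofTransfer γ F G θ).hom.app (op X) a =
      θ.hom.app (op (γ.obj X)) (kanMk a (𝟙 _) : KanValue γ F (γ.obj X)) := rfl

/-- The universal property of the Kan extension. -/
def transferEquiv (F : Pre S) (G : PreTr Cor) :
    (transferObj γ F ⟶ G) ≃ (F ⟶ (forgetTr γ).obj G) where
  toFun := ofTransfer γ F G
  invFun := toTransfer γ F G
  left_inv θ := by
    refine transferObj_hom_ext γ fun c X a φ => ?_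
    refine (toTransferApp_mk γ F G _ c X a φ).trans ?_
    rw [ofTransfer_app]
    have h := ConcreteCategory.congr_hom (θ.hom.naturality φ.op)
      (kanMk a (𝟙 _) : KanValue γ F (γ.obj X))
    change θ.hom.app (op c) (kanMap γ F φ (kanMk a (𝟙 _))) = _ at h
    rw [kanMap_mk, Category.comp_id] at h
    exact h.symm
  right_inv η := by
    apply ObjectProperty.hom_ext
    ext X a
    refine (toTransferApp_mk γ F G η _ X.unop a (𝟙 _)).trans ?_
    rw [op_id, G.obj.map_id]
    rfl

/-- The transfer functor `L_tr : Pre ⥤ Pre(Cor)`, the left Kan extension along `γ`. -/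
def transfer : Pre S ⥤ PreTr Cor :=
  Adjunction.leftAdjointOfEquiv (G := forgetTr γ) (transferEquiv γ) (fun _ _ _ _ _ => rfl)

/-- The adjunction `L_tr ⊣ F_tr`. -/
def transferAdj : transfer γ ⊣ forgetTr γ :=
  Adjunction.adjunctionOfEquivLeft (transferEquiv γ) (fun _ _ _ _ _ => rfl)

instance : (transfer γ).Additive := (transferAdj γ).left_adjoint_additive

end transfer

/-! ### Bounded above derived categories -/

section derived

variable (C D : Type*) [Category* C] [Category* D] [Abelian C] [Abelian D]

/-- The property of being a bounded above cochain complex. -/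
def boundedAbove : ObjectProperty (CochainComplex C ℤ) :=
  fun K => ∃ n : ℤ, K.IsStrictlyLE n

/-- The category `C⁻` of bounded above cochain complexes. -/
abbrev CompMinus := (boundedAbove C).FullSubcategory

variable {C D} in
/-- The functor induced by an additive functor on bounded above complexes. -/
def mapCompMinus (F : C ⥤ D) [F.Additive] : CompMinus C ⥤ CompMinus D :=
  (boundedAbove D).lift ((boundedAbove C).ι ⋙ F.mapHomologicalComplex _) (by
    rintro ⟨K, n, hn⟩
    refine ⟨n, ?_⟩
    rw [CochainComplex.isStrictlyLE_iff] at hn ⊢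
    exact fun i hi => F.map_isZero (hn i hi))

/-- The canonical (localization) functor from bounded above complexes to the bounded above
derived category. -/
def QMinus [HasDerivedCategory C] : CompMinus C ⥤ DerivedCategory.Minus C :=
  (DerivedCategory.TStructure.t (C := C)).minus.lift ((boundedAbove C).ι ⋙ DerivedCategory.Q) (by
    rintro ⟨K, n, hn⟩
    exact ⟨n, ⟨K, Iso.refl _, hn⟩⟩)

end derived

/-- `LL`, together with `α : Q ⋙ LL ⟶ F ⋙ Q`, is the total left derived functor
`D⁻(C) ⥤ D⁻(D)` of the additive functor `F : C ⥤ D`: it is the right Kan extension of `F ⋙ Q`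
along `Q`, i.e. terminal among such pairs. -/
def IsTotalLeftDerived {C D : Type*} [Category* C] [Category* D] [Abelian C] [Abelian D]
    [HasDerivedCategory C] [HasDerivedCategory D] (F : C ⥤ D) [F.Additive]
    (LL : DerivedCategory.Minus C ⥤ DerivedCategory.Minus D)
    (α : QMinus C ⋙ LL ⟶ mapCompMinus F ⋙ QMinus D) : Prop :=
  LL.IsRightKanExtension α

/-! ### Nisnevich quasi-isomorphisms and acyclic complexes -/

section nisnevich

variable {Cor : Type (u + 1)} [Category.{u} Cor] [Preadditive Cor] (γ : Sm S ⥤ Cor)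
  [PreservesFiniteCoproducts γ]

/-- The functor `A ↦ h^i(A)_nis`, the Nisnevich sheaf associated with the `i`-th cohomology
presheaf of a complex of presheaves. -/
def nisCohomology (S : Scheme.{u}) [HasDerivedCategory.{w₁} (Pre S)] (i : ℤ) :
    DerivedCategory.Minus (Pre S) ⥤ Sheaf (nisTopology S) AddCommGrpCat.{u + 1} :=
  DerivedCategory.Minus.ι ⋙ DerivedCategory.homologyFunctor (Pre S) i ⋙
    (additivePresheaf S).ι ⋙ presheafToSheaf (nisTopology S) AddCommGrpCat.{u + 1}

/-- The functor `A ↦ h^i(A)_nis` for complexes of presheaves with transfers: the Nisnevich sheaf on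
`Sm_S` associated with the underlying presheaf of the `i`-th cohomology. -/
def nisCohomologyTr [HasDerivedCategory.{w₂} (PreTr Cor)] (i : ℤ) :
    DerivedCategory.Minus (PreTr Cor) ⥤ Sheaf (nisTopology S) AddCommGrpCat.{u + 1} :=
  DerivedCategory.Minus.ι ⋙ DerivedCategory.homologyFunctor (PreTr Cor) i ⋙ forgetTr γ ⋙
    (additivePresheaf S).ι ⋙ presheafToSheaf (nisTopology S) AddCommGrpCat.{u + 1}

/-- Nisnevich acyclic complexes of presheaves. -/
def IsNisAcyclic [HasDerivedCategory.{w₁} (Pre S)] (A : DerivedCategory.Minus (Pre S)) : Prop :=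
  ∀ i : ℤ, IsZero ((nisCohomology S i).obj A)

/-- Nisnevich acyclic complexes of presheaves with transfers. -/
def IsNisAcyclicTr [HasDerivedCategory.{w₂} (PreTr Cor)]
    (A : DerivedCategory.Minus (PreTr Cor)) : Prop :=
  ∀ i : ℤ, IsZero ((nisCohomologyTr γ i).obj A)

/-- Nisnevich quasi-isomorphisms of complexes of presheaves. -/
def IsNisQuasiIso [HasDerivedCategory.{w₁} (Pre S)] {A B : DerivedCategory.Minus (Pre S)}
    (w : A ⟶ B) : Prop :=
  ∀ i : ℤ, IsIso ((nisCohomology S i).map w)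

/-- Nisnevich quasi-isomorphisms of complexes of presheaves with transfers. -/
def IsNisQuasiIsoTr [HasDerivedCategory.{w₂} (PreTr Cor)]
    {A B : DerivedCategory.Minus (PreTr Cor)} (w : A ⟶ B) : Prop :=
  ∀ i : ℤ, IsIso ((nisCohomologyTr γ i).map w)

end nisnevich

/-! ### Correspondences between henselian local schemes and condition (NL) -/

section NL

variable {Cor : Type (u + 1)} [Category.{u} Cor] [Preadditive Cor] (γ : Sm S ⥤ Cor)

/-- For `U = Y_y^h`, the functor `c ↦ Cor(U, c) = colim_W Cor(W, c)`, where `W` runs over the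
Nisnevich neighbourhoods of `y` in `Y`. -/
def corFromHensel (Y : Sm S) (y : Y.left) : Cor ⥤ AddCommGrpCat.{u + 1} :=
  preadditiveYoneda ⋙
    (Functor.whiskeringLeft _ _ _).obj ((NisNbhd.pro Y y).op ⋙ γ.op) ⋙
    (Functor.whiskeringRight _ _ _).obj AddCommGrpCat.uliftFunctor.{u + 1, u} ⋙ colim

/-- The group `Cor(Y_y^h, X_x^h) = lim_V colim_W Cor(W, V)` of morphisms of pro-objects of `Cor`,
where `V` and `W` run over the Nisnevich neighbourhoods of `x` in `X` and of `y` in `Y`. -/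
def corHensel (Y : Sm S) (y : Y.left) (X : Sm S) (x : X.left) : AddCommGrpCat.{u + 1} :=
  limit (NisNbhd.pro X x ⋙ γ ⋙ corFromHensel γ Y y)

/-- The map `Cor(Y_y^h, X_x^h) → Cor(Y_y^h, X)`, composition with `X_x^h → X`. -/
def corHenselTo (Y : Sm S) (y : Y.left) (X : Sm S) (x : X.left) :
    corHensel γ Y y X x →+ (corFromHensel γ Y y).obj (γ.obj X) :=
  (limit.π (NisNbhd.pro X x ⋙ γ ⋙ corFromHensel γ Y y) (NisNbhd.self X x)).hom

open Classical in
/-- Condition (NL): `⨁_{x ∈ X} Cor(U, X_x^h) → Cor(U, X)` is an isomorphism for every essentially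
smooth henselian local scheme `U = Y_y^h` and every smooth `X`. -/
def ConditionNL : Prop :=
  ∀ (Y : Sm S) (y : Y.left) (X : Sm S), Function.Bijective
    (DirectSum.toAddMonoid (fun x : X.left => corHenselTo γ Y y X x))

end NL

end NisTransfer

end

noncomputable section

namespace NisTransfer

variable {S : Scheme.{u}}

/-! ### Base change along étale morphisms in `Sm_S` -/

namespace Sm

/-! For a point `x` of `X`, the stalk `F ↦ F(X_x^h)` is a filtered colimit over Nisnevich
neighbourhoods, hence exact, and a map of presheaves becomes an isomorphism after Nisnevich
sheafification exactly when it is bijective on all stalks (`isIso_sheafify_iff_stalk_bijective`).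
Everything can therefore be tested on stalks, both for `Pre` and, after restriction, for `Pre(Cor)`.

Let `G F` be the Godement presheaf `X ↦ ∏_x F(X_x^h)`, with its natural map `F ⟶ G F`. If a complex
`K` has acyclic stalks, then `G K` is acyclic as a complex of presheaves, since products of abelian
groups are exact (`exact_map_godement`). Condition (NL) says that a germ of a correspondence `φ`
from `U = Y_y^h` to `X` is uniquely a finite sum of parts `φ_x` landing in `X_x^h`. Hence `(a_x) ⊗ φ
↦ ∑ a_x ⊗ φ_x` defines a natural map from the stalk of `L_tr(G F)` to that of `L_tr F`. It is left
inverse to the map induced by `F ⟶ G F` (`retraction`, `unit_retraction`).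

Now let `K` be `K`-projective with acyclic stalks. The map `K ⟶ G K` goes to an acyclic complex, so
it is null-homotopic, and this survives the additive functor "stalk of `L_tr`". By the retraction,
the identity of the stalk complex of `L_tr K` is null-homotopic too, so that complex is acyclic
(`acyclic_map_of_retraction`). Nothing is needed about exactness of `L_tr`, or about projectivity of
`G K`. Applied to a mapping cone, the argument handles quasi-isomorphisms between `K`-projective
complexes (`quasiIso_stalkTransfer`).

Finally `Pre` has enough projectives, so every object of the bounded above derived category is
represented by a bounded above complex of projectives. There the derived functor exists and is
computed by `L_tr` itself (`LiftsAt`, `IsTotalLeftDerived.isIso_app`). The acyclicity statement is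
read off from the quasi-isomorphism statement, applied to the zero endomorphism. -/

lemma hom_left_comp {V X : Sm S} (f : V ⟶ X) : f.left ≫ X.hom = V.hom :=
  CategoryTheory.Over.w f.hom

@[simp]
lemma comp_left' {U V X : Sm S} (f : U ⟶ V) (g : V ⟶ X) : (f ≫ g).left = f.left ≫ g.left := rfl

@[simp]
lemma id_left' (X : Sm S) : (𝟙 X : X ⟶ X).left = 𝟙 X.left := rfl

lemma left_condition {V X Y : Sm S} {f : V ⟶ X} {g : Y ⟶ X} (s : PullbackCone f g) :
    s.fst.left ≫ f.left = s.snd.left ≫ g.left :=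
  congrArg (fun t => t.left) s.condition

section

variable {V X Y : Sm S} (f : V ⟶ X) (g : Y ⟶ X)

/-- The base change of an étale morphism `f : V ⟶ X` along `g : Y ⟶ X`. -/
abbrev baseChange [Etale f.left] : Sm S :=
  MorphismProperty.Over.mk ⊤ (pullback.snd f.left g.left ≫ Y.hom) (by
    have := isSeparated_left f
    have := quasiCompact_left f
    have hY : Smooth Y.hom := Y.prop.1
    have hY' : IsSeparated Y.hom := Y.prop.2.1
    have hY'' : QuasiCompact Y.hom := Y.prop.2.2
    exact ⟨inferInstance, inferInstance, inferInstance⟩)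

variable [Etale f.left]

def baseChangeSnd : baseChange f g ⟶ Y :=
  MorphismProperty.Over.homMk (pullback.snd f.left g.left) rfl trivial

def baseChangeFst : baseChange f g ⟶ V :=
  MorphismProperty.Over.homMk (pullback.fst f.left g.left) (by
    change pullback.fst f.left g.left ≫ V.hom = pullback.snd f.left g.left ≫ Y.hom
    rw [← hom_left_comp f, ← hom_left_comp g, pullback.condition_assoc]) trivial

@[simp]
lemma baseChangeSnd_left : (baseChangeSnd f g).left = pullback.snd f.left g.left := rfl

instance : Etale (baseChangeSnd f g).left :=
  inferInstanceAs (Etale (pullback.snd f.left g.left))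

lemma baseChange_condition : baseChangeFst f g ≫ f = baseChangeSnd f g ≫ g := by
  ext
  exact pullback.condition

/-- Fibre products of smooth schemes need not be smooth over `S`. When one leg is étale, the
scheme-theoretic fibre product stays in `Sm S` and so is a pullback there. -/
lemma isPullback_baseChange : IsPullback (baseChangeFst f g) (baseChangeSnd f g) f g where
  w := baseChange_condition f g
  isLimit' := ⟨PullbackCone.IsLimit.mk _
    (fun s => MorphismProperty.Over.homMk
      (pullback.lift s.fst.left s.snd.left (left_condition s)) ((pullback.lift_snd_assoc
        s.fst.left s.snd.left (left_condition s) Y.hom).trans (hom_left_comp s.snd)) trivial)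
    (fun s => by ext; exact pullback.lift_fst _ _ _)
    (fun s => by ext; exact pullback.lift_snd _ _ _)
    (fun s m h₁ h₂ => by
      ext
      refine pullback.hom_ext (f := f.left) (g := g.left) ?_ ?_
      · exact (congrArg (fun t => t.left) h₁).trans
          (pullback.lift_fst s.fst.left s.snd.left (left_condition s)).symm
      · exact (congrArg (fun t => t.left) h₂).trans
          (pullback.lift_snd s.fst.left s.snd.left (left_condition s)).symm)⟩

/-- The spectra of residue fields are in general not objects of `Sm S`, so maps out of them must be
compared in schemes. -/
lemma isPullback_baseChange_left :
    IsPullback (baseChangeFst f g).left (baseChangeSnd f g).left f.left g.left :=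
  IsPullback.of_hasPullback f.left g.left

end

end Sm

/-! ### Residue fields and neighbourhoods -/

/-- The morphism `Spec κ(x) ⟶ Spec κ(y)` induced by `f : X ⟶ Y` with `f(x) = y`. -/
def residueMap {X Y : Sm S} (f : X ⟶ Y) {x : X.left} {y : Y.left} (h : f.left x = y) :
    Spec (X.left.residueField x) ⟶ Spec (Y.left.residueField y) :=
  Spec.map (f.left.residueFieldMap x) ≫ eqToHom (by rw [h])

@[simp]
lemma residueMap_fromSpec {X Y : Sm S} (f : X ⟶ Y) {x : X.left} {y : Y.left}
    (h : f.left x = y) :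
    residueMap f h ≫ Y.left.fromSpecResidueField y = X.left.fromSpecResidueField x ≫ f.left := by
  subst h
  simp [residueMap, Scheme.Hom.SpecMap_residueFieldMap_fromSpecResidueField]

/-- `Spec κ(y) ⟶ Y` is a monomorphism. This yields the functoriality of residue maps without
computing with fields. -/
lemma eq_residueMap {X Y : Sm S} (f : X ⟶ Y) {x : X.left} {y : Y.left} (h : f.left x = y)
    (t : Spec (X.left.residueField x) ⟶ Spec (Y.left.residueField y))
    (ht : t ≫ Y.left.fromSpecResidueField y = X.left.fromSpecResidueField x ≫ f.left) :
    t = residueMap f h := by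
  rw [← cancel_mono (Y.left.fromSpecResidueField y), ht, residueMap_fromSpec]

lemma residueMap_id {X : Sm S} {x : X.left} (h : (𝟙 X : X ⟶ X).left x = x) :
    residueMap (𝟙 X) h = 𝟙 _ :=
  (eq_residueMap _ _ _ (by simp)).symm

lemma residueMap_comp {X Y Z : Sm S} (f : X ⟶ Y) (g : Y ⟶ Z) {x : X.left} {y : Y.left}
    {z : Z.left} (h : f.left x = y) (h' : g.left y = z) (h'' : (f ≫ g).left x = z) :
    residueMap f h ≫ residueMap g h' = residueMap (f ≫ g) h'' :=
  eq_residueMap _ _ _ (by simp [reassoc_of% residueMap_fromSpec f h])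

namespace NisNbhd

instance {X : Sm S} {x : X.left} (A : NisNbhd X x) : Etale A.f.left := A.etale

@[simp]
lemma comp_g {X : Sm S} {x : X.left} {A B C : NisNbhd X x} (a : A ⟶ B) (b : B ⟶ C) :
    (a ≫ b).g = a.g ≫ b.g := rfl

@[simp]
lemma id_g {X : Sm S} {x : X.left} (A : NisNbhd X x) : (𝟙 A : A ⟶ A).g = 𝟙 A.V := rfl

attribute [simp] Hom.w Hom.w'

section comap

variable {X Y : Sm S} (f : X ⟶ Y) {x : X.left} {y : Y.left} (h : f.left x = y)

/-- The pullback of neighbourhoods of `y = f(x)` along `f`. -/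
def comapObj (B : NisNbhd Y y) : NisNbhd X x where
  V := Sm.baseChange B.f f
  f := Sm.baseChangeSnd B.f f
  etale := inferInstance
  s := pullback.lift (residueMap f h ≫ B.s) (X.left.fromSpecResidueField x) (by
    rw [Category.assoc, B.fac, residueMap_fromSpec])
  fac := pullback.lift_snd _ _ _

/-- The projection of `f^* B` to `B`. -/
def comapFst (B : NisNbhd Y y) : (comapObj f h B).V ⟶ B.V := Sm.baseChangeFst B.f f

lemma comapFst_f (B : NisNbhd Y y) : comapFst f h B ≫ B.f = (comapObj f h B).f ≫ f :=
  Sm.baseChange_condition _ _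

lemma comapObj_s_comapFst (B : NisNbhd Y y) :
    (comapObj f h B).s ≫ (comapFst f h B).left = residueMap f h ≫ B.s :=
  pullback.lift_fst _ _ _

variable {f h} in
/-- The universal property of `f^* B`. -/
def comapLift {A : NisNbhd X x} {B : NisNbhd Y y} (q : A.V ⟶ B.V) (hq : q ≫ B.f = A.f ≫ f)
    (hs : A.s ≫ q.left = residueMap f h ≫ B.s) : A ⟶ comapObj f h B where
  g := (Sm.isPullback_baseChange B.f f).lift q A.f hq
  w := (Sm.isPullback_baseChange B.f f).lift_snd _ _ _
  w' := by
    have h₁ := (Sm.isPullback_baseChange B.f f).lift_fst q A.f hq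
    have h₂ := (Sm.isPullback_baseChange B.f f).lift_snd q A.f hq
    apply (Sm.isPullback_baseChange_left B.f f).hom_ext
    · refine (Category.assoc _ _ _).trans (Eq.trans ?_ (pullback.lift_fst _ _ _).symm)
      exact (congrArg (fun t => A.s ≫ t.left) h₁).trans hs
    · refine (Category.assoc _ _ _).trans (Eq.trans ?_ (pullback.lift_snd _ _ _).symm)
      exact (congrArg (fun t => A.s ≫ t.left) h₂).trans A.fac

variable {f h} in
lemma comapLift_fst {A : NisNbhd X x} {B : NisNbhd Y y} (q : A.V ⟶ B.V)
    (hq : q ≫ B.f = A.f ≫ f) (hs : A.s ≫ q.left = residueMap f h ≫ B.s) :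
    (comapLift q hq hs).g ≫ comapFst f h B = q :=
  (Sm.isPullback_baseChange B.f f).lift_fst _ _ _

variable {f h} in
lemma comap_hom_ext {A : NisNbhd X x} {B : NisNbhd Y y} {a b : A ⟶ comapObj f h B}
    (hab : a.g ≫ comapFst f h B = b.g ≫ comapFst f h B) : a = b :=
  Hom.ext ((Sm.isPullback_baseChange B.f f).hom_ext hab (a.w.trans b.w.symm))

/-- Pullback of neighbourhoods as a functor. -/
def comap : NisNbhd Y y ⥤ NisNbhd X x where
  obj B := comapObj f h B
  map {B B'} b := comapLift (comapFst f h B ≫ b.g)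
    (by rw [Category.assoc, b.w, comapFst_f])
    (by rw [Sm.comp_left', ← Category.assoc, comapObj_s_comapFst, Category.assoc, b.w'])
  map_id B := comap_hom_ext (by rw [comapLift_fst]; simp)
  map_comp a b := comap_hom_ext (by
    rw [comapLift_fst, comp_g, comp_g, Category.assoc, comapLift_fst, reassoc_of% comapLift_fst,
      Category.assoc])

/-- The projection `f^* B ⟶ B`, as a morphism of pro-objects. -/
def comapPro : comap f h ⋙ pro X x ⟶ pro Y y where
  app B := comapFst f h B
  naturality B B' b := comapLift_fst (comapFst f h B ≫ b.g)
    (by rw [Category.assoc, b.w, comapFst_f])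
    (by rw [Sm.comp_left', ← Category.assoc, comapObj_s_comapFst, Category.assoc, b.w'])

end comap

/-! ### Neighbourhoods form a cofiltered category -/

section cofiltered

variable {X : Sm S} {x : X.left}

/-- The fibre product of two neighbourhoods. -/
def inf (A B : NisNbhd X x) : NisNbhd X x where
  V := Sm.baseChange A.f B.f
  f := Sm.baseChangeSnd A.f B.f ≫ B.f
  etale := by rw [Sm.comp_left']; infer_instance
  s := pullback.lift A.s B.s (A.fac.trans B.fac.symm)
  fac := by
    rw [Sm.comp_left', Sm.baseChangeSnd_left]
    exact (pullback.lift_snd_assoc _ _ _ _).trans B.fac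

def infFst (A B : NisNbhd X x) : inf A B ⟶ A where
  g := Sm.baseChangeFst A.f B.f
  w := Sm.baseChange_condition A.f B.f
  w' := pullback.lift_fst _ _ _

def infSnd (A B : NisNbhd X x) : inf A B ⟶ B where
  g := Sm.baseChangeSnd A.f B.f
  w := rfl
  w' := pullback.lift_snd _ _ _

/-- Two parallel morphisms of neighbourhoods agree on a smaller neighbourhood, since the diagonal
of an étale morphism is étale. -/
lemma exists_equalizing {A B : NisNbhd X x} (a b : A ⟶ B) :
    ∃ (E : NisNbhd X x) (e : E ⟶ A), e ≫ a = e ≫ b := by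
  let δ : B.V ⟶ Sm.baseChange B.f B.f := (Sm.isPullback_baseChange B.f B.f).lift (𝟙 _) (𝟙 _) rfl
  have hδ₁ : δ ≫ Sm.baseChangeFst B.f B.f = 𝟙 _ := IsPullback.lift_fst _ _ _ _
  have hδ₂ : δ ≫ Sm.baseChangeSnd B.f B.f = 𝟙 _ := IsPullback.lift_snd _ _ _ _
  have : Etale δ.left := by
    have : Etale (δ.left ≫ (Sm.baseChangeSnd B.f B.f).left) := by
      rw [← Sm.comp_left', hδ₂, Sm.id_left']; infer_instance
    exact Etale.of_comp δ.left (Sm.baseChangeSnd B.f B.f).left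
  let c : A.V ⟶ Sm.baseChange B.f B.f :=
    (Sm.isPullback_baseChange B.f B.f).lift a.g b.g (a.w.trans b.w.symm)
  have hc₁ : c ≫ Sm.baseChangeFst B.f B.f = a.g := IsPullback.lift_fst _ _ _ _
  have hc₂ : c ≫ Sm.baseChangeSnd B.f B.f = b.g := IsPullback.lift_snd _ _ _ _
  have hs : B.s ≫ δ.left = A.s ≫ c.left := by
    apply (Sm.isPullback_baseChange_left B.f B.f).hom_ext
    · rw [Category.assoc, Category.assoc, ← Sm.comp_left', ← Sm.comp_left', hδ₁, hc₁, a.w']; simp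
    · rw [Category.assoc, Category.assoc, ← Sm.comp_left', ← Sm.comp_left', hδ₂, hc₂, b.w']; simp
  -- `E` is the preimage of the diagonal of `B` over `X` under `(a, b)`. The base point lifts to it
  -- because `a` and `b` send `A.s` to the same `B.s`.
  let E : NisNbhd X x :=
    { V := Sm.baseChange δ c
      f := Sm.baseChangeSnd δ c ≫ A.f
      etale := by rw [Sm.comp_left']; infer_instance
      s := pullback.lift B.s A.s hs
      fac := by
        rw [Sm.comp_left', Sm.baseChangeSnd_left]
        exact (pullback.lift_snd_assoc _ _ _ _).trans A.fac }
  refine ⟨E, ⟨Sm.baseChangeSnd δ c, rfl, pullback.lift_snd _ _ _⟩, Hom.ext ?_⟩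
  change Sm.baseChangeSnd δ c ≫ a.g = Sm.baseChangeSnd δ c ≫ b.g
  rw [← hc₁, ← hc₂, ← reassoc_of% Sm.baseChange_condition, ← reassoc_of% Sm.baseChange_condition,
    hδ₁, hδ₂]

/-- Makes the stalks filtered colimits, hence exact and described by germs. -/
instance : IsCofiltered (NisNbhd X x) where
  nonempty := ⟨self X x⟩
  cone_objs A B := ⟨inf A B, infFst A B, infSnd A B, trivial⟩
  cone_maps _ _ a b := exists_equalizing a b

end cofiltered

/-- A neighbourhood of `x` in `X` is a neighbourhood of `y = f(x)` in `Y` if `f : X ⟶ Y` is étale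
and `Spec κ(x) ⟶ Spec κ(y)` has a section. -/
def map {X Y : Sm S} (f : X ⟶ Y) [Etale f.left] {x : X.left} {y : Y.left} (h : f.left x = y)
    (t : Spec (Y.left.residueField y) ⟶ Spec (X.left.residueField x))
    (ht : t ≫ residueMap f h = 𝟙 _) (A : NisNbhd X x) : NisNbhd Y y where
  V := A.V
  f := A.f ≫ f
  etale := by rw [Sm.comp_left']; infer_instance
  s := t ≫ A.s
  fac := by
    rw [Category.assoc, Sm.comp_left', ← Category.assoc A.s, A.fac, ← residueMap_fromSpec f h,
      reassoc_of% ht]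

/-- A neighbourhood of `x` that maps to a neighbourhood `B` of `f(x)` refines `B`. -/
def mapLift {X Y : Sm S} (f : X ⟶ Y) [Etale f.left] {x : X.left} {y : Y.left}
    (h : f.left x = y) (t : Spec (Y.left.residueField y) ⟶ Spec (X.left.residueField x))
    (ht : t ≫ residueMap f h = 𝟙 _) {A : NisNbhd X x} {B : NisNbhd Y y} (q : A.V ⟶ B.V)
    (hq : q ≫ B.f = A.f ≫ f) (hs : A.s ≫ q.left = residueMap f h ≫ B.s) :
    A.map f h t ht ⟶ B where
  g := q
  w := hq
  w' := (Category.assoc _ _ _).trans ((congrArg (t ≫ ·) hs).trans (by rw [reassoc_of% ht]))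

/-- The lift of `x` to a neighbourhood. -/
def pt {X : Sm S} {x : X.left} (A : NisNbhd X x) : A.V.left :=
  (exists_fac_fromSpecResidueField A.s).choose

/-- The section of `Spec κ(v) ⟶ Spec κ(x)` for the lift `v` of `x` to a neighbourhood. -/
def sectionPt {X : Sm S} {x : X.left} (A : NisNbhd X x) :
    Spec (X.left.residueField x) ⟶ Spec (A.V.left.residueField A.pt) :=
  (exists_fac_fromSpecResidueField A.s).choose_spec.choose

lemma sectionPt_fromSpec {X : Sm S} {x : X.left} (A : NisNbhd X x) :
    A.sectionPt ≫ A.V.left.fromSpecResidueField A.pt = A.s :=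
  (exists_fac_fromSpecResidueField A.s).choose_spec.choose_spec

end NisNbhd

end NisTransfer
end

noncomputable section

namespace NisTransfer

variable {S : Scheme.{u}}

/-! ### Stalks at henselian local schemes -/

section stalk

/-- The objects of `NisNbhd X x` lie one universe above its morphisms. Lifting the morphisms gives
an equivalent category that is small for universe `u + 1`, where filtered colimits of groups are
computed on sets. -/
instance (X : Sm S) (x : X.left) :
    PreservesColimitsOfShape (NisNbhd X x)ᵒᵖ (forget AddCommGrpCat.{u + 1}) := by
  have : IsFiltered (ULiftHom.{u + 1} (NisNbhd X x)ᵒᵖ) :=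
    IsFiltered.of_equivalence (ULiftHom.equiv (C := (NisNbhd X x)ᵒᵖ))
  have : PreservesColimitsOfShape (ULiftHom.{u + 1} (NisNbhd X x)ᵒᵖ)
      (forget AddCommGrpCat.{u + 1}) :=
    PreservesFilteredColimitsOfSize.preserves_filtered_colimits _
  exact preservesColimitsOfShape_of_equiv (ULiftHom.equiv (C := (NisNbhd X x)ᵒᵖ)).symm _

/-- The value of presheaves at the henselian local scheme `X_x^h`. -/
def stalkFunctor (X : Sm S) (x : X.left) :
    ((Sm S)ᵒᵖ ⥤ AddCommGrpCat.{u + 1}) ⥤ AddCommGrpCat.{u + 1} :=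
  (Functor.whiskeringLeft _ _ _).obj (NisNbhd.pro X x).op ⋙ colim

instance (X : Sm S) (x : X.left) : PreservesFiniteLimits (stalkFunctor X x) := by
  have : PreservesFiniteLimits
      (colim : ((NisNbhd X x)ᵒᵖ ⥤ AddCommGrpCat.{u + 1}) ⥤ AddCommGrpCat.{u + 1}) :=
    inferInstance
  exact comp_preservesFiniteLimits _ _

instance (X : Sm S) (x : X.left) : PreservesFiniteColimits (stalkFunctor X x) := by
  have : PreservesFiniteColimits
      (colim : ((NisNbhd X x)ᵒᵖ ⥤ AddCommGrpCat.{u + 1}) ⥤ AddCommGrpCat.{u + 1}) :=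
    ⟨fun _ _ _ => inferInstance⟩
  exact comp_preservesFiniteColimits _ _

instance (X : Sm S) (x : X.left) : (stalkFunctor X x).Additive :=
  Functor.additive_of_preserves_binary_products _

variable (F : (Sm S)ᵒᵖ ⥤ AddCommGrpCat.{u + 1})

variable {X Y Z : Sm S} {x : X.left} {y : Y.left} {z : Z.left}

/-- The germ at `X_x^h` of a section on a neighbourhood. -/
def germ (A : NisNbhd X x) : F.obj (op A.V) ⟶ (stalkFunctor X x).obj F :=
  colimit.ι ((NisNbhd.pro X x).op ⋙ F) (op A)

variable {F}

lemma map_op_map_op {U V W : Sm S} (f : U ⟶ V) (g : V ⟶ W) (s : F.obj (op W)) :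
    F.map f.op (F.map g.op s) = F.map (f ≫ g).op s := by
  rw [op_comp, F.map_comp]; rfl

lemma germ_res {A B : NisNbhd X x} (a : A ⟶ B) (s : F.obj (op B.V)) :
    germ F A (F.map a.g.op s) = germ F B s :=
  ConcreteCategory.congr_hom (colimit.w ((NisNbhd.pro X x).op ⋙ F) a.op) s

lemma exists_germ (z : (stalkFunctor X x).obj F) :
    ∃ (A : NisNbhd X x) (s : F.obj (op A.V)), germ F A s = z := by
  obtain ⟨A, s, h⟩ := Concrete.colimit_exists_rep ((NisNbhd.pro X x).op ⋙ F) z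
  exact ⟨A.unop, s, h⟩

lemma exists_res_eq_of_germ_eq {A : NisNbhd X x} {s t : F.obj (op A.V)}
    (h : germ F A s = germ F A t) :
    ∃ (B : NisNbhd X x) (b : B ⟶ A), F.map b.g.op s = F.map b.g.op t := by
  obtain ⟨B, b, hb⟩ := (IsColimit.eq_iff' (colimit.isColimit ((NisNbhd.pro X x).op ⋙ F))
    (i := op A) s t).1 h
  exact ⟨B.unop, b.unop, hb⟩

lemma stalkFunctor_map_germ {G : (Sm S)ᵒᵖ ⥤ AddCommGrpCat.{u + 1}} (η : F ⟶ G)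
    (A : NisNbhd X x) (s : F.obj (op A.V)) :
    (stalkFunctor X x).map η (germ F A s) = germ G A (η.app _ s) :=
  ConcreteCategory.congr_hom (ι_colimMap ((NisNbhd.pro X x).op.whiskerLeft η) (op A)) s

variable (F)

/-- The map `F(Y_y^h) ⟶ F(X_x^h)` induced by `f : X ⟶ Y` with `f(x) = y`. -/
def stalkRes (f : X ⟶ Y) (h : f.left x = y) :
    (stalkFunctor Y y).obj F ⟶ (stalkFunctor X x).obj F :=
  colimit.desc ((NisNbhd.pro Y y).op ⋙ F)
    { pt := (stalkFunctor X x).obj F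
      ι :=
        { app := fun B => F.map (NisNbhd.comapFst f h B.unop).op ≫
            germ F (NisNbhd.comapObj f h B.unop)
          naturality := fun B B' b => ConcreteCategory.hom_ext _ _
              fun (s : F.obj (op B.unop.V)) => by
            have e : ((NisNbhd.comap f h).map b.unop).g ≫ NisNbhd.comapFst f h B.unop =
                NisNbhd.comapFst f h B'.unop ≫ b.unop.g := (NisNbhd.comapPro f h).naturality b.unop
            exact (congrArg (germ F (NisNbhd.comapObj f h B'.unop))
              ((map_op_map_op _ _ s).trans ((congrArg (fun k => F.map k.op s) e.symm).trans
                (map_op_map_op _ _ s).symm))).trans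
              (germ_res ((NisNbhd.comap f h).map b.unop)
                (F.map (NisNbhd.comapFst f h B.unop).op s)) } }

variable {F}

lemma stalkRes_germ' (f : X ⟶ Y) (h : f.left x = y) (B : NisNbhd Y y) (s : F.obj (op B.V)) :
    stalkRes F f h (germ F B s) =
      germ F (NisNbhd.comapObj f h B) (F.map (NisNbhd.comapFst f h B).op s) :=
  ConcreteCategory.congr_hom (colimit.ι_desc (F := (NisNbhd.pro Y y).op ⋙ F) _ (op B)) s

/-- Such an `A` maps to the pulled-back neighbourhood by its universal property, so the restriction
may be computed on any convenient `A` rather than on the fibre product. -/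
lemma stalkRes_germ (f : X ⟶ Y) (h : f.left x = y) (B : NisNbhd Y y) (s : F.obj (op B.V))
    (A : NisNbhd X x) (q : A.V ⟶ B.V) (hq : q ≫ B.f = A.f ≫ f)
    (hs : A.s ≫ q.left = residueMap f h ≫ B.s) :
    stalkRes F f h (germ F B s) = germ F A (F.map q.op s) := by
  rw [stalkRes_germ', ← germ_res (NisNbhd.comapLift q hq hs), map_op_map_op,
    NisNbhd.comapLift_fst]

lemma stalkRes_id (h : (𝟙 X : X ⟶ X).left x = x) (z : (stalkFunctor X x).obj F) :
    stalkRes F (𝟙 X) h z = z := by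
  obtain ⟨A, s, rfl⟩ := exists_germ z
  rw [stalkRes_germ _ _ A s A (𝟙 _) (by simp) (by rw [residueMap_id]; simp)]
  simp

lemma stalkRes_comp (f : X ⟶ Y) (g : Y ⟶ Z) (h : f.left x = y) (h' : g.left y = z)
    (h'' : (f ≫ g).left x = z) (a : (stalkFunctor Z z).obj F) :
    stalkRes F f h (stalkRes F g h' a) = stalkRes F (f ≫ g) h'' a := by
  obtain ⟨A, s, rfl⟩ := exists_germ a
  rw [stalkRes_germ' g, stalkRes_germ' f, stalkRes_germ (f ≫ g) h'' A s _
    (NisNbhd.comapFst f h (NisNbhd.comapObj g h' A) ≫ NisNbhd.comapFst g h' A), map_op_map_op]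
  · rw [Category.assoc, NisNbhd.comapFst_f, reassoc_of% NisNbhd.comapFst_f]
  · rw [Sm.comp_left', ← Category.assoc, NisNbhd.comapObj_s_comapFst, Category.assoc,
      NisNbhd.comapObj_s_comapFst, reassoc_of% residueMap_comp]

lemma stalkRes_naturality {G : (Sm S)ᵒᵖ ⥤ AddCommGrpCat.{u + 1}} (η : F ⟶ G)
    (f : X ⟶ Y) (h : f.left x = y) (z : (stalkFunctor Y y).obj F) :
    stalkRes G f h ((stalkFunctor Y y).map η z) =
      (stalkFunctor X x).map η (stalkRes F f h z) := by
  obtain ⟨A, s, rfl⟩ := exists_germ z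
  rw [stalkFunctor_map_germ, stalkRes_germ', stalkRes_germ', stalkFunctor_map_germ,
    NatTrans.naturality_apply]

/-- The stalk does not change under étale morphisms that do not change the residue field. -/
lemma stalkRes_bijective (f : X ⟶ Y) [Etale f.left] (h : f.left x = y) [IsIso (residueMap f h)] :
    Function.Bijective (stalkRes F f h) := by
  -- The inverse of the residue map turns a neighbourhood of `x` into one of `y` by composing with
  -- the étale `f`. This gives surjectivity, and the same construction refines neighbourhoods for
  -- injectivity.
  have key (A : NisNbhd X x) (s : F.obj (op A.V)) :
      stalkRes F f h (germ F (A.map f h (inv (residueMap f h)) (by simp)) s) = germ F A s := by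
    rw [stalkRes_germ f h (A.map f h (inv (residueMap f h)) (by simp)) s A (𝟙 _)]
    · exact congrArg (germ F A) (ConcreteCategory.congr_hom (F.map_id _) s)
    · exact Category.id_comp _
    · change A.s ≫ 𝟙 _ = residueMap f h ≫ inv (residueMap f h) ≫ A.s
      simp
  refine ⟨?_, fun z => ?_⟩
  · rw [injective_iff_map_eq_zero]
    intro z hz
    obtain ⟨B, s, rfl⟩ := exists_germ z
    rw [stalkRes_germ'] at hz
    obtain ⟨A, a, ha⟩ := exists_res_eq_of_germ_eq (hz.trans (map_zero (germ F _).hom).symm)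
    have hq : (a.g ≫ NisNbhd.comapFst f h B) ≫ B.f = A.f ≫ f := by
      rw [Category.assoc, NisNbhd.comapFst_f, reassoc_of% a.w]
    have hs : A.s ≫ (a.g ≫ NisNbhd.comapFst f h B).left = residueMap f h ≫ B.s := by
      rw [Sm.comp_left', reassoc_of% a.w', NisNbhd.comapObj_s_comapFst]
    have e : F.map (a.g ≫ NisNbhd.comapFst f h B).op s = 0 := by
      rw [← map_op_map_op, ha, map_zero]
    let b := NisNbhd.mapLift f h (inv (residueMap f h)) (by simp) _ hq hs
    exact (germ_res b s).symm.trans ((congrArg (germ F (A.map f h _ _)) e).trans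
      (map_zero (germ F (A.map f h _ _)).hom))
  · obtain ⟨A, s, rfl⟩ := exists_germ z
    exact ⟨_, key A s⟩

end stalk

end NisTransfer
end

noncomputable section

namespace NisTransfer

variable {S : Scheme.{u}}

/-! ### Sheafification and stalks -/

section detection

variable {F G : (Sm S)ᵒᵖ ⥤ AddCommGrpCat.{u + 1}} (η : F ⟶ G)

/-- A Nisnevich neighbourhood of the lift of `x` to `A` is a neighbourhood of `x` refining `A`. -/
lemma NisNbhd.exists_refinement {X : Sm S} {x : X.left} (A : NisNbhd X x) {W : Sm S}
    (f : W ⟶ A.V) (hf : IsNisnevichAt f A.pt) :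
    ∃ (B : NisNbhd X x) (b : B ⟶ A) (e : B.V = W), b.g = eqToHom e ≫ f := by
  obtain ⟨_, s, hs⟩ := hf
  refine ⟨{ V := W
            f := f ≫ A.f
            etale := by rw [Sm.comp_left']; infer_instance
            s := A.sectionPt ≫ s
            fac := by
              rw [Sm.comp_left', Category.assoc, reassoc_of% hs, reassoc_of% A.sectionPt_fromSpec,
                A.fac] }, ⟨f, rfl, ?_⟩, rfl, (Category.id_comp _).symm⟩
  change (A.sectionPt ≫ s) ≫ f.left = A.s
  rw [Category.assoc, hs, A.sectionPt_fromSpec]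

/-- A germ at `x` lives on some neighbourhood `A`. A covering sieve of `A.V` contains a Nisnevich
neighbourhood of the lifted point `A.pt`, and this is again a neighbourhood of `x` refining `A`. -/
lemma stalk_bijective_of_W (h : (nisTopology S).W η) (X : Sm S) (x : X.left) :
    Function.Bijective ((stalkFunctor X x).map η) := by
  obtain ⟨hi, hs⟩ := (GrothendieckTopology.W_iff_isLocallyBijective _ _).1 h
  refine ⟨?_, fun z => ?_⟩
  · rw [injective_iff_map_eq_zero]
    intro z hz
    obtain ⟨A, s, rfl⟩ := exists_germ z
    rw [stalkFunctor_map_germ] at hz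
    obtain ⟨B, b, hb⟩ := exists_res_eq_of_germ_eq (hz.trans (map_zero (germ G A).hom).symm)
    rw [← germ_res b]
    have h0 : η.app (op B.V) (F.map b.g.op s) = η.app (op B.V) 0 := by
      rw [NatTrans.naturality_apply, hb, map_zero, map_zero]
    obtain ⟨W, f, hf, hn⟩ := hi.equalizerSieve_mem _ _ h0 B.pt
    obtain ⟨C, c, rfl, hc⟩ := B.exists_refinement f hn
    rw [eqToHom_refl, Category.id_comp] at hc
    have hf' : F.map f.op (F.map b.g.op s) = F.map f.op 0 := hf
    rw [← germ_res c, hc, hf', map_zero, map_zero]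
  · obtain ⟨A, s, rfl⟩ := exists_germ z
    obtain ⟨W, f, ⟨t, ht⟩, hn⟩ := hs.imageSieve_mem s A.pt
    obtain ⟨C, c, rfl, hc⟩ := A.exists_refinement f hn
    rw [eqToHom_refl, Category.id_comp] at hc
    refine ⟨germ F C t, ?_⟩
    rw [stalkFunctor_map_germ, ht, ← hc, germ_res]

/-- Equality of germs at `x`, or lifting of a germ at `x`, is already realised on one neighbourhood
of `x`. Doing this at every `x` is exactly what makes the relevant sieve covering. -/
lemma W_of_stalk_bijective
    (h : ∀ (X : Sm S) (x : X.left), Function.Bijective ((stalkFunctor X x).map η)) :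
    (nisTopology S).W η := by
  refine (GrothendieckTopology.W_iff_isLocallyBijective _ _).2 ⟨⟨fun {X} s t hst x => ?_⟩,
    ⟨fun {X} s x => ?_⟩⟩
  · have e : germ F (NisNbhd.self X.unop x) s = germ F (NisNbhd.self X.unop x) t :=
      (h X.unop x).1 ((stalkFunctor_map_germ η (NisNbhd.self X.unop x) s).trans
        ((congrArg (germ G (NisNbhd.self X.unop x)) hst).trans
          (stalkFunctor_map_germ η (NisNbhd.self X.unop x) t).symm))
    obtain ⟨B, b, hb⟩ := exists_res_eq_of_germ_eq e
    have hbf : b.g = B.f := (Category.comp_id _).symm.trans b.w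
    exact ⟨B.V, B.f, by rw [← hbf]; exact hb, B.etale, B.s, B.fac⟩
  · let s' : G.obj (op (NisNbhd.self X x).V) := s
    obtain ⟨z, hz⟩ := (h X x).2 (germ G (NisNbhd.self X x) s')
    obtain ⟨A, t, rfl⟩ := exists_germ z
    let C := NisNbhd.inf A (NisNbhd.self X x)
    have e : germ G C (η.app (op C.V) (F.map (NisNbhd.infFst A (NisNbhd.self X x)).g.op t)) =
        germ G C (G.map (NisNbhd.infSnd A (NisNbhd.self X x)).g.op s') := by
      rw [NatTrans.naturality_apply, germ_res, germ_res, ← hz, stalkFunctor_map_germ]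
    obtain ⟨B, b, hb⟩ := exists_res_eq_of_germ_eq e
    have hbf : b.g ≫ (NisNbhd.infSnd A (NisNbhd.self X x)).g = B.f := by
      have := (b ≫ NisNbhd.infSnd A (NisNbhd.self X x)).w
      exact (Category.comp_id _).symm.trans this
    refine ⟨B.V, B.f, ⟨F.map b.g.op (F.map (NisNbhd.infFst A (NisNbhd.self X x)).g.op t), ?_⟩,
      B.etale, B.s, B.fac⟩
    rw [NatTrans.naturality_apply, hb]
    exact (map_op_map_op b.g (NisNbhd.infSnd A (NisNbhd.self X x)).g s').trans
      (congrArg (fun k => G.map k.op s) hbf)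

/-- A morphism of presheaves is an isomorphism on associated sheaves if and only if it is bijective
on stalks. -/
lemma isIso_sheafify_iff_stalk_bijective :
    IsIso ((presheafToSheaf (nisTopology S) AddCommGrpCat.{u + 1}).map η) ↔
      ∀ (X : Sm S) (x : X.left), Function.Bijective ((stalkFunctor X x).map η) :=
  (GrothendieckTopology.W_iff _ _).symm.trans ⟨stalk_bijective_of_W η, W_of_stalk_bijective η⟩

end detection

/-! ### The Godement presheaf -/

section godement

variable (F : (Sm S)ᵒᵖ ⥤ AddCommGrpCat.{u + 1})

/-- The stalks form a family of groups indexed by points, so equal image points still require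
transport. -/
lemma stalkRes_congr {F : (Sm S)ᵒᵖ ⥤ AddCommGrpCat.{u + 1}} {X Y : Sm S} (f : X ⟶ Y) {x : X.left}
    {y y' : Y.left} (a : ∀ y : Y.left, (stalkFunctor Y y).obj F) (h : f.left x = y)
    (h' : f.left x = y') : stalkRes F f h (a y) = stalkRes F f h' (a y') := by
  subst h h'
  rfl

/-- The presheaf `X ↦ ∏_{x ∈ X} F(X_x^h)`. -/
def godementObj : (Sm S)ᵒᵖ ⥤ AddCommGrpCat.{u + 1} where
  obj X := AddCommGrpCat.of (∀ x : X.unop.left, (stalkFunctor X.unop x).obj F)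
  map {Y X} f := AddCommGrpCat.ofHom
    { toFun := fun a x => stalkRes F f.unop rfl (a (f.unop.left x))
      map_zero' := by
        funext x
        exact map_zero (stalkRes F f.unop rfl).hom
      map_add' := fun a b => by
        funext x
        exact map_add (stalkRes F f.unop rfl).hom _ _ }
  map_id X := by
    ext a x
    exact (stalkRes_congr (𝟙 X.unop) a rfl rfl).trans (stalkRes_id (X := X.unop) (x := x) rfl (a x))
  map_comp {Z Y X} g f := by
    ext a x
    exact (stalkRes_comp f.unop g.unop rfl rfl rfl (a _)).symm

/-- Functoriality of the Godement presheaf. -/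
def godementPsh : ((Sm S)ᵒᵖ ⥤ AddCommGrpCat.{u + 1}) ⥤ ((Sm S)ᵒᵖ ⥤ AddCommGrpCat.{u + 1}) where
  obj := godementObj
  map {F G} η :=
    { app := fun X => AddCommGrpCat.ofHom
        { toFun := fun a x => (stalkFunctor X.unop x).map η (a x)
          map_zero' := by
            funext x
            exact map_zero ((stalkFunctor X.unop x).map η).hom
          map_add' := fun a b => by
            funext x
            exact map_add ((stalkFunctor X.unop x).map η).hom _ _ }
      naturality := fun Y X f => by
        ext a
        funext x
        exact (stalkRes_naturality η f.unop rfl (a _)).symm }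
  map_id F := by
    ext X a
    funext x
    exact ConcreteCategory.congr_hom ((stalkFunctor X.unop x).map_id F) (a x)
  map_comp η θ := by
    ext X a
    funext x
    exact ConcreteCategory.congr_hom ((stalkFunctor X.unop x).map_comp η θ) (a x)

/-- The map `F(X) ⟶ ∏_{x ∈ X} F(X_x^h)`. -/
def toGodement : F ⟶ godementObj F where
  app X := AddCommGrpCat.ofHom
    { toFun := fun s x => germ F (NisNbhd.self X.unop x) s
      map_zero' := by
        funext x
        exact map_zero (germ F (NisNbhd.self X.unop x)).hom
      map_add' := fun a b => by
        funext x
        exact map_add (germ F (NisNbhd.self X.unop x)).hom _ _ }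
  naturality Y X f := by
    ext s
    funext x
    refine (stalkRes_germ f.unop rfl (NisNbhd.self Y.unop _) s (NisNbhd.self X.unop x) f.unop
      ?_ ?_).symm
    · exact (Category.comp_id _).trans (Category.id_comp _).symm
    · exact (residueMap_fromSpec f.unop rfl).symm

lemma toGodement_naturality {F G : (Sm S)ᵒᵖ ⥤ AddCommGrpCat.{u + 1}} (η : F ⟶ G) :
    η ≫ toGodement G = toGodement F ≫ godementPsh.map η := by
  ext X s
  funext x
  exact (stalkFunctor_map_germ η (NisNbhd.self X.unop x) s).symm

end godement

end NisTransfer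
end

noncomputable section

namespace NisTransfer

variable {S : Scheme.{u}}

/-! ### Finite coproducts in `Sm_S` -/

namespace Sm

/-- The forgetful functor to schemes. -/
abbrev toScheme (S : Scheme.{u}) : Sm S ⥤ Scheme.{u} :=
  MorphismProperty.Over.forget smoothProperty ⊤ S ⋙ Over.forget S

/-- Separatedness and quasi-compactness are local on the target, so they pass to `coprod.map`. The
remaining fold map `S ⨿ S ⟶ S` has both properties. -/
lemma coprodDesc_eq {X Y : Scheme.{u}} (f : X ⟶ S) (g : Y ⟶ S) :
    coprod.desc f g = coprod.map f g ≫ coprod.desc (𝟙 S) (𝟙 S) := by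
  simp

/-- The disjoint union in `Sm_S`. -/
def disjUnion (X Y : Sm S) : Sm S :=
  MorphismProperty.Over.mk ⊤ (coprod.desc X.hom Y.hom) (by
    obtain ⟨hX, hX', hX''⟩ : smoothProperty X.hom := X.prop
    obtain ⟨hY, hY', hY''⟩ : smoothProperty Y.hom := Y.prop
    refine ⟨?_, ?_, ?_⟩
    · have : IsZariskiLocalAtSource @Smooth.{u} :=
        @HasRingHomProperty.instIsZariskiLocalAtSource _ _ instHasRingHomPropertySmoothSmooth
      rw [IsZariskiLocalAtSource.iff_of_openCover (P := @Smooth) (coprodOpenCover.{u, 0} _ _)]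
      have hl : Smooth (coprod.inl ≫ coprod.desc X.hom Y.hom) := by rwa [coprod.inl_desc]
      have hr : Smooth (coprod.inr ≫ coprod.desc X.hom Y.hom) := by rwa [coprod.inr_desc]
      rintro (_ | _)
      exacts [hl, hr]
    · have : IsSeparated (coprod.map X.hom Y.hom) :=
        IsZariskiLocalAtTarget.coprodMap (P := @IsSeparated) _ _ hX' hY'
      rw [coprodDesc_eq]
      infer_instance
    · have : IsZariskiLocalAtTarget @QuasiCompact.{u} :=
        @HasAffineProperty.instIsZariskiLocalAtTarget _ _
          instHasAffinePropertyQuasiCompactCompactSpaceCarrierCarrierCommRingCat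
      have : QuasiCompact (coprod.map X.hom Y.hom) :=
        IsZariskiLocalAtTarget.coprodMap (P := @QuasiCompact) _ _ hX'' hY''
      rw [coprodDesc_eq]
      infer_instance)

def disjUnionInl (X Y : Sm S) : X ⟶ disjUnion X Y :=
  MorphismProperty.Over.homMk coprod.inl (coprod.inl_desc X.hom Y.hom) trivial

def disjUnionInr (X Y : Sm S) : Y ⟶ disjUnion X Y :=
  MorphismProperty.Over.homMk coprod.inr (coprod.inr_desc X.hom Y.hom) trivial

instance (X Y : Sm S) : IsOpenImmersion (disjUnionInl X Y).left :=
  inferInstanceAs (IsOpenImmersion (coprod.inl : X.left ⟶ X.left ⨿ Y.left))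

instance (X Y : Sm S) : IsOpenImmersion (disjUnionInr X Y).left :=
  inferInstanceAs (IsOpenImmersion (coprod.inr : Y.left ⟶ X.left ⨿ Y.left))

abbrev disjUnionCofan (X Y : Sm S) : BinaryCofan X Y :=
  BinaryCofan.mk (disjUnionInl X Y) (disjUnionInr X Y)

def disjUnionIsColimit (X Y : Sm S) : IsColimit (disjUnionCofan X Y) :=
  BinaryCofan.isColimitMk
    (fun s => MorphismProperty.Over.homMk (coprod.desc s.inl.left s.inr.left)
      (coprod.hom_ext
        ((coprod.inl_desc_assoc _ _ _).trans
          ((hom_left_comp s.inl).trans (coprod.inl_desc X.hom Y.hom).symm))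
        ((coprod.inr_desc_assoc _ _ _).trans
          ((hom_left_comp s.inr).trans (coprod.inr_desc X.hom Y.hom).symm))) trivial)
    (fun s => by ext; exact coprod.inl_desc _ _)
    (fun s => by ext; exact coprod.inr_desc _ _)
    (fun s m h₁ h₂ => by
      ext
      refine coprod.hom_ext (X := X.left) (Y := Y.left) ?_ ?_
      · exact (congrArg (fun t => t.left) h₁).trans (coprod.inl_desc s.inl.left s.inr.left).symm
      · exact (congrArg (fun t => t.left) h₂).trans (coprod.inr_desc s.inl.left s.inr.left).symm)

instance : HasBinaryCoproducts (Sm S) :=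
  have {X Y : Sm S} : HasColimit (pair X Y) :=
    HasColimit.mk ⟨disjUnionCofan X Y, disjUnionIsColimit X Y⟩
  hasBinaryCoproducts_of_hasColimit_pair _

/-- The empty scheme as an object of `Sm_S`. -/
def empty (S : Scheme.{u}) : Sm S :=
  MorphismProperty.Over.mk ⊤ (initial.to S) ⟨inferInstance, inferInstance, inferInstance⟩

def emptyIsInitial (S : Scheme.{u}) : IsInitial (empty S) :=
  IsInitial.ofUniqueHom
    (fun X => MorphismProperty.Over.homMk (initial.to X.left)
      (initialIsInitial.hom_ext _ _) trivial)
    (fun X m => by ext; exact initialIsInitial.hom_ext _ _)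

instance : HasInitial (Sm S) := (emptyIsInitial S).hasInitial

instance : HasFiniteCoproducts (Sm S) := hasFiniteCoproducts_of_has_binary_and_initial

instance : PreservesColimitsOfShape (Discrete WalkingPair) (toScheme S) := by
  have (X Y : Sm S) : PreservesColimit (pair X Y) (toScheme S) :=
    preservesColimit_of_preserves_colimit_cocone (disjUnionIsColimit X Y)
      ((isColimitMapCoconeBinaryCofanEquiv (toScheme S) _ _).symm (coprodIsCoprod X.left Y.left))
  exact ⟨fun {K} => preservesColimit_of_iso_diagram _ (diagramIsoPair K).symm⟩

instance : (toScheme S).ReflectsIsomorphisms := inferInstance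

instance : ReflectsColimitsOfShape (Discrete WalkingPair) (toScheme S) :=
  reflectsColimitsOfShape_of_reflectsIsomorphisms

instance : ReflectsLimitsOfShape WalkingCospan (toScheme S) := inferInstance

lemma isOpenImmersion_inl (X Y : Sm S) : IsOpenImmersion (coprod.inl : X ⟶ X ⨿ Y).left := by
  have h : (disjUnionCofan X Y).inl ≫ ((disjUnionIsColimit X Y).coconePointUniqueUpToIso
      (coprodIsCoprod X Y)).hom = coprod.inl :=
    IsColimit.comp_coconePointUniqueUpToIso_hom (disjUnionIsColimit X Y) (coprodIsCoprod X Y)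
      ⟨WalkingPair.left⟩
  have : IsIso ((disjUnionIsColimit X Y).coconePointUniqueUpToIso
      (coprodIsCoprod X Y)).hom.left :=
    inferInstanceAs (IsIso ((toScheme S).map ((disjUnionIsColimit X Y).coconePointUniqueUpToIso
      (coprodIsCoprod X Y)).hom))
  have : IsOpenImmersion (disjUnionCofan X Y).inl.left :=
    inferInstanceAs (IsOpenImmersion (coprod.inl : X.left ⟶ X.left ⨿ Y.left))
  have h' : IsOpenImmersion ((disjUnionCofan X Y).inl.left ≫
    ((disjUnionIsColimit X Y).coconePointUniqueUpToIso (coprodIsCoprod X Y)).hom.left) :=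
    inferInstance
  exact (congrArg (fun t => IsOpenImmersion t.left) h).mp h'

lemma etale_inl (X Y : Sm S) : Etale (coprod.inl : X ⟶ X ⨿ Y).left :=
  have := isOpenImmersion_inl X Y
  inferInstance

/-- Coproduct inclusions are open immersions, hence étale, so the available base changes suffice. -/
instance : HasPullbacksOfInclusions (Sm S) where
  hasPullbackInl {X Y _} f :=
    have := etale_inl X Y
    (isPullback_baseChange coprod.inl f).hasPullback

instance : PreservesPullbacksOfInclusions (toScheme S) where
  preservesPullbackInl {X Y _} f := by
    have := etale_inl X Y
    refine preservesLimit_of_preserves_limit_cone (isPullback_baseChange coprod.inl f).isLimit ?_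
    exact (isLimitMapConePullbackConeEquiv (toScheme S)
      (baseChange_condition coprod.inl f)).symm
        (isPullback_baseChange_left coprod.inl f).isLimit

/-- Needed to identify additive presheaves with sheaves for the extensive topology, whose
sheafification supplies the projective generators. -/
instance : FinitaryExtensive (Sm S) :=
  finitaryExtensive_of_preserves_and_reflects (toScheme S)

end Sm

end NisTransfer
end

noncomputable section

namespace NisTransfer

variable {S : Scheme.{u}}

/-! ### The Godement presheaf is additive -/

lemma nonempty_isLimit_binaryFan_ab {A B C : AddCommGrpCat.{u}} (f : C ⟶ A) (g : C ⟶ B)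
    (h : Function.Bijective (fun c : C => ((f c, g c) : A × B))) :
    Nonempty (IsLimit (BinaryFan.mk f g)) := by
  let φ : C ⟶ (AddCommGrpCat.binaryProductLimitCone A B).cone.pt :=
    AddCommGrpCat.ofHom (f.hom.prod g.hom)
  have : IsIso φ := (ConcreteCategory.isIso_iff_bijective _).2 h
  let e : C ≅ (AddCommGrpCat.binaryProductLimitCone A B).cone.pt := asIso φ
  exact ⟨IsLimit.ofIsoLimit (AddCommGrpCat.binaryProductLimitCone A B).isLimit
    (BinaryFan.ext e rfl rfl).symm⟩

lemma isIso_residueMap_of_isOpenImmersion {X Y : Sm S} (f : X ⟶ Y) [IsOpenImmersion f.left]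
    {x : X.left} {y : Y.left} (h : f.left x = y) : IsIso (residueMap f h) := by
  subst h
  have : IsIso (f.left.residueFieldMap x) := inferInstance
  unfold residueMap
  infer_instance

variable (F : (Sm S)ᵒᵖ ⥤ AddCommGrpCat.{u + 1})

/-- The points of `Z` are those of `X` together with those of `Y`, and an open immersion changes
neither residue fields nor stalks. The product over the points of `Z` therefore splits. -/
lemma godement_prod_bijective {X Y Z : Sm S} (i : X ⟶ Z) (j : Y ⟶ Z) [IsOpenImmersion i.left]
    [IsOpenImmersion j.left] (e : X.left ⊕ Y.left ≃ Z.left) (e₁ : ∀ x, e (.inl x) = i.left x)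
    (e₂ : ∀ x, e (.inr x) = j.left x) : Function.Bijective
    (fun a : (godementObj F).obj (op Z) =>
      (((godementObj F).map i.op a, (godementObj F).map j.op a) :
        (godementObj F).obj (op X) × (godementObj F).obj (op Y))) := by
  have hi (x) : Function.Bijective (stalkRes F i (rfl : i.left x = _)) :=
    have := isIso_residueMap_of_isOpenImmersion i (rfl : i.left x = _)
    stalkRes_bijective i rfl
  have hj (x) : Function.Bijective (stalkRes F j (rfl : j.left x = _)) :=
    have := isIso_residueMap_of_isOpenImmersion j (rfl : j.left x = _)
    stalkRes_bijective j rfl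
  constructor
  · intro a b hab
    funext z
    obtain ⟨z, rfl⟩ := e.surjective z
    rcases z with x | x
    · rw [e₁]
      exact (hi x).1 (congrFun (congrArg Prod.fst hab) x)
    · rw [e₂]
      exact (hj x).1 (congrFun (congrArg Prod.snd hab) x)
  · rintro ⟨a, b⟩
    choose a' ha' using fun x => (hi x).2 (a x)
    choose b' hb' using fun x => (hj x).2 (b x)
    -- The casts are forced because `e (.inl x)` and `i.left x` index the same stalk only up to a
    -- proved equality.
    let c₀ : ∀ z : X.left ⊕ Y.left, (stalkFunctor Z (e z)).obj F :=
      Sum.rec (fun x => cast (by rw [e₁]) (a' x)) (fun x => cast (by rw [e₂]) (b' x))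
    let c : ∀ z, (stalkFunctor Z z).obj F := fun z =>
      cast (by rw [e.apply_symm_apply]) (c₀ (e.symm z))
    have hc (z) : c (e z) = c₀ z := by
      rw [← heq_iff_eq]
      refine (cast_heq _ _).trans ?_
      rw [e.symm_apply_apply]
    have hc₁ (x) : c (i.left x) = a' x := by
      rw [← heq_iff_eq]
      exact ((congr_arg_heq c (e₁ x)).symm.trans (heq_of_eq (hc (.inl x)))).trans (cast_heq _ _)
    have hc₂ (x) : c (j.left x) = b' x := by
      rw [← heq_iff_eq]
      exact ((congr_arg_heq c (e₂ x)).symm.trans (heq_of_eq (hc (.inr x)))).trans (cast_heq _ _)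
    refine ⟨c, Prod.ext ?_ ?_⟩
    · funext x
      exact (congrArg (stalkRes F i rfl) (hc₁ x)).trans (ha' x)
    · funext x
      exact (congrArg (stalkRes F j rfl) (hc₂ x)).trans (hb' x)

lemma godement_disjUnion_bijective (X Y : Sm S) : Function.Bijective
    (fun a : (godementObj F).obj (op (Sm.disjUnion X Y)) =>
      (((godementObj F).map (Sm.disjUnionInl X Y).op a,
        (godementObj F).map (Sm.disjUnionInr X Y).op a) :
        (godementObj F).obj (op X) × (godementObj F).obj (op Y))) :=
  godement_prod_bijective F _ _ (coprodMk X.left Y.left).toEquiv (coprodMk_inl _ _)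
    (coprodMk_inr _ _)

lemma godement_empty_subsingleton : Subsingleton ((godementObj F).obj (op (Sm.empty S))) := by
  have : IsEmpty (Sm.empty S).left := inferInstanceAs (IsEmpty (⊥_ Scheme.{u}))
  exact inferInstanceAs (Subsingleton (∀ x : (Sm.empty S).left, (stalkFunctor _ x).obj F))

lemma preservesFiniteProducts_of_disjUnion (G : (Sm S)ᵒᵖ ⥤ AddCommGrpCat.{u + 1})
    (h₀ : Subsingleton (G.obj (op (Sm.empty S))))
    (h : ∀ X Y : Sm S, Function.Bijective (fun a : G.obj (op (Sm.disjUnion X Y)) =>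
      ((G.map (Sm.disjUnionInl X Y).op a, G.map (Sm.disjUnionInr X Y).op a) :
        G.obj (op X) × G.obj (op Y)))) : PreservesFiniteProducts G := by
  have : PreservesLimit (Functor.empty.{0} (Sm S)ᵒᵖ) G := by
    refine preservesLimit_of_preserves_limit_cone
      (terminalOpOfInitial (Sm.emptyIsInitial S)) ?_
    refine (isLimitMapConeEmptyConeEquiv G _).symm ?_
    exact (AddCommGrpCat.isZero_of_subsingleton _).isTerminal
  have : PreservesLimitsOfShape (Discrete PEmpty.{1}) G :=
    preservesLimitsOfShape_pempty_of_preservesTerminal G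
  have : PreservesLimitsOfShape (Discrete WalkingPair) G := by
    have (X Y : (Sm S)ᵒᵖ) : PreservesLimit (pair X Y) G :=
      preservesLimit_of_preserves_limit_cone
        (t := BinaryFan.mk (Sm.disjUnionInl X.unop Y.unop).op
          (Sm.disjUnionInr X.unop Y.unop).op)
        (BinaryCofan.IsColimit.op (Sm.disjUnionIsColimit X.unop Y.unop))
        ((isLimitMapConeBinaryFanEquiv G _ _).symm
          (nonempty_isLimit_binaryFan_ab _ _ (h X.unop Y.unop)).some)
    exact ⟨fun {K} => preservesLimit_of_iso_diagram _ (diagramIsoPair K).symm⟩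
  exact PreservesFiniteProducts.of_preserves_binary_and_terminal G

instance : PreservesFiniteProducts (godementObj F) :=
  preservesFiniteProducts_of_disjUnion _ (godement_empty_subsingleton F)
    (godement_disjUnion_bijective F)

/-- The Godement functor on additive presheaves. -/
def godement (S : Scheme.{u}) : Pre S ⥤ Pre S :=
  (additivePresheaf S).lift ((additivePresheaf S).ι ⋙ godementPsh)
    (fun F => inferInstanceAs (PreservesFiniteProducts (godementObj F.obj)))

/-- The unit of the Godement functor. -/
def godementUnit (S : Scheme.{u}) : 𝟭 (Pre S) ⟶ godement S where
  app F := ObjectProperty.homMk (toGodement F.obj)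
  naturality F G η := by
    apply ObjectProperty.hom_ext
    exact toGodement_naturality η.hom

instance : (godement S).Additive where
  map_add {F G} f g := by
    apply ObjectProperty.hom_ext
    ext X a
    funext x
    exact ConcreteCategory.congr_hom ((stalkFunctor X.unop x).map_add (f := f.hom) (g := g.hom))
      (a x)

end NisTransfer
end

noncomputable section

namespace NisTransfer

variable {S : Scheme.{u}}

/-! ### Exactness of the forgetful functors -/

instance (J : Type) [SmallCategory J] :
    (additivePresheaf S).IsClosedUnderLimitsOfShape J where
  limitsOfShape_le := by
    rintro F ⟨h⟩
    exact preservesFiniteProducts_of_isLimit h.isLimit h.prop_diag_obj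

/-- Finite products of abelian groups are biproducts, so they commute with colimits as well as with
limits. -/
instance (J : Type) [SmallCategory J] :
    (additivePresheaf S).IsClosedUnderColimitsOfShape J where
  colimitsOfShape_le := by
    rintro F ⟨h⟩
    exact preservesFiniteProducts_of_isColimit h.isColimit h.prop_diag_obj

instance : PreservesFiniteLimits (additivePresheaf S).ι := ⟨fun _ _ _ => inferInstance⟩

instance : PreservesFiniteColimits (additivePresheaf S).ι := ⟨fun _ _ _ => inferInstance⟩

instance : (additivePresheaf S).ι.Additive where
  map_add := rfl

lemma Psh.exact_iff (T : ShortComplex ((Sm S)ᵒᵖ ⥤ AddCommGrpCat.{u + 1})) :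
    T.Exact ↔ ∀ X, (T.map ((evaluation _ _).obj X)).Exact := by
  refine ⟨fun h X => h.map _, fun h => ?_⟩
  rw [ShortComplex.exact_iff_isZero_homology, Functor.isZero_iff]
  intro X
  have := (ShortComplex.exact_iff_isZero_homology _).1 (h X)
  exact this.of_iso (T.mapHomologyIso ((evaluation _ _).obj X)).symm

lemma Pre.exact_iff (T : ShortComplex (Pre S)) :
    T.Exact ↔ ∀ X, (T.map ((additivePresheaf S).ι ⋙ (evaluation _ _).obj X)).Exact :=
  (T.exact_map_iff_of_faithful (additivePresheaf S).ι).symm.trans (Psh.exact_iff _)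

/-- The Godement functor transforms sequences that are exact on stalks into exact sequences. -/
lemma exact_map_godement (T : ShortComplex (Pre S))
    (hT : ∀ (X : Sm S) (x : X.left),
      (T.map ((additivePresheaf S).ι ⋙ stalkFunctor X x)).Exact) :
    (T.map (godement S)).Exact := by
  rw [Pre.exact_iff]
  intro X
  rw [ShortComplex.ab_exact_iff]
  intro b hb
  have h (x : X.unop.left) := (ShortComplex.ab_exact_iff _).1 (hT X.unop x) (b x) (congrFun hb x)
  choose a ha using h
  exact ⟨a, funext ha⟩

/-! ### Exactness of the stalks of presheaves with transfers -/

section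

variable {Cor : Type (u + 1)} [Category.{u} Cor] [Preadditive Cor] (γ : Sm S ⥤ Cor)
  [PreservesFiniteCoproducts γ]

instance : (AdditiveFunctor.forget Corᵒᵖ AddCommGrpCat.{u + 1}).Additive where
  map_add := rfl

instance : PreservesFiniteLimits (AdditiveFunctor.forget Corᵒᵖ AddCommGrpCat.{u + 1}) := by
  have : ∀ {X Y : PreTr Cor} (f : X ⟶ Y), PreservesLimit (parallelPair f 0)
      (AdditiveFunctor.forget Corᵒᵖ AddCommGrpCat.{u + 1}) :=
    fun f => (additiveFunctor Corᵒᵖ AddCommGrpCat.{u + 1}).preservesKernels_ι f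
  exact Functor.preservesFiniteLimits_of_preservesKernels _

instance : PreservesFiniteColimits (AdditiveFunctor.forget Corᵒᵖ AddCommGrpCat.{u + 1}) := by
  have : ∀ {X Y : PreTr Cor} (f : X ⟶ Y), PreservesColimit (parallelPair f 0)
      (AdditiveFunctor.forget Corᵒᵖ AddCommGrpCat.{u + 1}) :=
    fun f => (additiveFunctor Corᵒᵖ AddCommGrpCat.{u + 1}).preservesCokernels_ι f
  exact Functor.preservesFiniteColimits_of_preservesCokernels _

/-- The stalk at `y` of the presheaf underlying a presheaf with transfers. -/
abbrev stalkTr (Y : Sm S) (y : Y.left) : PreTr Cor ⥤ AddCommGrpCat.{u + 1} :=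
  (forgetTr γ ⋙ (additivePresheaf S).ι) ⋙ stalkFunctor Y y

instance : PreservesFiniteLimits (forgetTr γ ⋙ (additivePresheaf S).ι) :=
  inferInstanceAs (PreservesFiniteLimits (AdditiveFunctor.forget Corᵒᵖ AddCommGrpCat.{u + 1} ⋙
    (Functor.whiskeringLeft _ _ AddCommGrpCat.{u + 1}).obj γ.op))

instance : PreservesFiniteColimits (forgetTr γ ⋙ (additivePresheaf S).ι) :=
  inferInstanceAs (PreservesFiniteColimits (AdditiveFunctor.forget Corᵒᵖ AddCommGrpCat.{u + 1} ⋙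
    (Functor.whiskeringLeft _ _ AddCommGrpCat.{u + 1}).obj γ.op))

instance (Y : Sm S) (y : Y.left) : PreservesFiniteLimits (stalkTr γ Y y) :=
  comp_preservesFiniteLimits _ _

instance (Y : Sm S) (y : Y.left) : PreservesFiniteColimits (stalkTr γ Y y) :=
  comp_preservesFiniteColimits _ _

instance (Y : Sm S) (y : Y.left) : (stalkTr γ Y y).Additive := inferInstance

end

end NisTransfer
end

noncomputable section

namespace NisTransfer

variable {S : Scheme.{u}}

/-! ### The pairing of stalks with correspondences between henselian local schemes -/

section pairing

variable {Cor : Type (u + 1)} [Category.{u} Cor] [Preadditive Cor] (γ : Sm S ⥤ Cor)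

/-- The presheaf `W ↦ Cor(W, c)` on `Sm_S`, as a functor of `c`. -/
def corPsh : Cor ⥤ ((Sm S)ᵒᵖ ⥤ AddCommGrpCat.{u + 1}) :=
  preadditiveYoneda ⋙ (Functor.whiskeringLeft _ _ _).obj γ.op ⋙
    (Functor.whiskeringRight _ _ _).obj AddCommGrpCat.uliftFunctor.{u + 1, u}

variable {γ} in
/-- The germ of a correspondence. -/
def corGerm {Y : Sm S} {y : Y.left} (W : NisNbhd Y y) {c : Cor} (φ : γ.obj W.V ⟶ c) :
    (corFromHensel γ Y y).obj c :=
  germ ((corPsh γ).obj c) W (ULift.up φ)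

section

variable {γ} {Y : Sm S} {y : Y.left} {c c' : Cor}

lemma corGerm_add (W : NisNbhd Y y) (φ ψ : γ.obj W.V ⟶ c) :
    corGerm W (φ + ψ) = corGerm W φ + corGerm W ψ :=
  map_add (germ ((corPsh γ).obj c) W).hom _ _

lemma corGerm_res {W W' : NisNbhd Y y} (g : W' ⟶ W) (φ : γ.obj W.V ⟶ c) :
    corGerm W' (γ.map g.g ≫ φ) = corGerm W φ :=
  germ_res (F := (corPsh γ).obj c) g (ULift.up φ)

lemma corFromHensel_map_corGerm (W : NisNbhd Y y) (φ : γ.obj W.V ⟶ c) (g : c ⟶ c') :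
    (corFromHensel γ Y y).map g (corGerm W φ) = corGerm W (φ ≫ g) :=
  stalkFunctor_map_germ ((corPsh γ).map g) W (ULift.up φ)

lemma exists_corGerm {c : Cor} (z : (corFromHensel γ Y y).obj c) :
    ∃ (W : NisNbhd Y y) (φ : γ.obj W.V ⟶ c), corGerm W φ = z := by
  obtain ⟨W, φ, h⟩ := exists_germ (F := (corPsh γ).obj c) z
  exact ⟨W, φ.down, h⟩

/-- The projections of `Cor(Y_y^h, X_x^h)`. -/
def corHenselπ {X : Sm S} {x : X.left} (A : NisNbhd X x) :
    corHensel γ Y y X x →+ (corFromHensel γ Y y).obj (γ.obj A.V) :=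
  (limit.π (NisNbhd.pro X x ⋙ γ ⋙ corFromHensel γ Y y) A).hom

lemma corHenselπ_map {X : Sm S} {x : X.left} {A B : NisNbhd X x} (g : A ⟶ B)
    (ξ : corHensel γ Y y X x) :
    (corFromHensel γ Y y).map (γ.map g.g) (corHenselπ A ξ) = corHenselπ B ξ :=
  ConcreteCategory.congr_hom (limit.w (NisNbhd.pro X x ⋙ γ ⋙ corFromHensel γ Y y) g) ξ

/-- The cone defining the pushforward on `Cor(Y_y^h, X_x^h)`. -/
def corHenselPushCone {X X' : Sm S} (f : X ⟶ X') {x : X.left} {x' : X'.left}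
    (h : f.left x = x') : Cone (NisNbhd.pro X' x' ⋙ γ ⋙ corFromHensel γ Y y) :=
  { pt := corHensel γ Y y X x
    π :=
      { app := fun B => limit.π (NisNbhd.pro X x ⋙ γ ⋙ corFromHensel γ Y y)
          (NisNbhd.comapObj f h B) ≫
            (corFromHensel γ Y y).map (γ.map (NisNbhd.comapFst f h B))
        naturality := fun B B' g => by
          have h₁ := limit.w (NisNbhd.pro X x ⋙ γ ⋙ corFromHensel γ Y y)
            ((NisNbhd.comap f h).map g)
          have h₂ := congrArg (fun t => (corFromHensel γ Y y).map (γ.map t))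
            ((NisNbhd.comapPro f h).naturality g)
          refine (Category.id_comp _).trans ?_
          refine (congrArg (· ≫ _) h₁.symm).trans ?_
          refine (Category.assoc _ _ _).trans ?_
          refine .trans ?_ (Category.assoc _ _ _).symm
          refine congrArg (_ ≫ ·) ?_
          rw [Functor.map_comp, Functor.map_comp, Functor.map_comp, Functor.map_comp] at h₂
          exact h₂ } }

/-- The pushforward `Cor(Y_y^h, X_x^h) ⟶ Cor(Y_y^h, X'_{x'}^h)` along `f : X ⟶ X'`,
`f(x) = x'`. -/
def corHenselPush {X X' : Sm S} (f : X ⟶ X') {x : X.left} {x' : X'.left} (h : f.left x = x') :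
    corHensel γ Y y X x ⟶ corHensel γ Y y X' x' :=
  limit.lift _ (corHenselPushCone f h)

lemma corHenselπ_push {X X' : Sm S} (f : X ⟶ X') {x : X.left} {x' : X'.left}
    (h : f.left x = x') (B : NisNbhd X' x') (ξ : corHensel γ Y y X x) :
    corHenselπ B (corHenselPush f h ξ) =
      (corFromHensel γ Y y).map (γ.map (NisNbhd.comapFst f h B))
        (corHenselπ (NisNbhd.comapObj f h B) ξ) :=
  ConcreteCategory.congr_hom
    (limit.lift_π (corHenselPushCone (γ := γ) (Y := Y) (y := y) f h) B) ξ

/-- The trivial neighbourhood of `x'` pulls back to one that maps to the trivial neighbourhood of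
`x`. Both sides are thus read off from the same projection of `ξ`. -/
lemma corHenselTo_push {X X' : Sm S} (f : X ⟶ X') {x : X.left} {x' : X'.left}
    (h : f.left x = x') (ξ : corHensel γ Y y X x) :
    corHenselTo γ Y y X' x' (corHenselPush f h ξ) =
      (corFromHensel γ Y y).map (γ.map f) (corHenselTo γ Y y X x ξ) := by
  let B := NisNbhd.self X' x'
  let b : NisNbhd.comapObj f h B ⟶ NisNbhd.self X x :=
    ⟨(NisNbhd.comapObj f h B).f, Category.comp_id _, (NisNbhd.comapObj f h B).fac⟩
  have h₁ : NisNbhd.comapFst f h B = b.g ≫ f :=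
    (Category.comp_id _).symm.trans (NisNbhd.comapFst_f f h B)
  refine (corHenselπ_push f h B ξ).trans ?_
  have h₂ := corHenselπ_map b ξ
  refine .trans ?_ (congrArg ((corFromHensel γ Y y).map (γ.map f)) h₂)
  rw [h₁]
  exact ConcreteCategory.congr_hom (((congrArg _ (γ.map_comp b.g f)).trans
    ((corFromHensel γ Y y).map_comp (γ.map b.g) (γ.map f)))) _

end

variable {γ} in
/-- The map `Cor(U, c) ⟶ (L_tr F)(U)`, `φ ↦ s ⊗ φ` of presheaves in `U`. -/
def kanTensor [PreservesFiniteCoproducts γ] (F : Pre S) {V : Sm S} (s : F.obj.obj (op V)) :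
    (corPsh γ).obj (γ.obj V) ⟶
      (forgetTr γ ⋙ (additivePresheaf S).ι).obj ((transfer γ).obj F) where
  app W := AddCommGrpCat.ofHom
    (AddMonoidHom.mk' (fun ψ : ULift.{u + 1} (γ.obj W.unop ⟶ γ.obj V) =>
      (kanMk s ψ.down : KanValue γ F (γ.obj W.unop)))
      (fun a b => kanMk_add_right s a.down b.down))
  naturality W W' g := by
    ext ψ
    exact (kanMap_mk γ F (γ.map g.unop) s ψ.down).symm

variable [PreservesFiniteCoproducts γ]

/-- `(transfer γ).map η` maps `a ⊗ φ` to `η(a) ⊗ φ`. -/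
lemma transfer_map_kanMk {F G : Pre S} (η : F ⟶ G) (c : Cor) {X : Sm S} (a : F.obj.obj (op X))
    (φ : c ⟶ γ.obj X) :
    ((transfer γ).map η).hom.app (op c) (kanMk a φ : KanValue γ F c) =
      (kanMk (η.hom.app (op X) a) φ : KanValue γ G c) := by
  refine (toTransferApp_mk γ F _ (η ≫ ofTransfer γ G _ (𝟙 _)) c X a φ).trans ?_
  refine (kanMap_mk γ G φ (η.hom.app (op X) a) (𝟙 _)).trans ?_
  rw [Category.comp_id]

/-- The stalk at `y` of `F_tr L_tr F`. -/
abbrev stalkTransfer (Y : Sm S) (y : Y.left) : Pre S ⥤ AddCommGrpCat.{u + 1} :=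
  transfer γ ⋙ stalkTr γ Y y

section

variable {γ} {Y : Sm S} {y : Y.left}

/-- The germ of an element of `L_tr F`. -/
def kanGerm {F : Pre S} (W : NisNbhd Y y) : KanValue γ F (γ.obj W.V) →+
    (stalkTransfer γ Y y).obj F :=
  (germ ((forgetTr γ ⋙ (additivePresheaf S).ι).obj ((transfer γ).obj F)) W).hom

lemma exists_kanGerm {F : Pre S} (z : (stalkTransfer γ Y y).obj F) :
    ∃ (W : NisNbhd Y y) (w : KanValue γ F (γ.obj W.V)), kanGerm W w = z := by
  obtain ⟨W, w, h⟩ := exists_germ (F := (forgetTr γ ⋙ (additivePresheaf S).ι).obj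
    ((transfer γ).obj F)) z
  exact ⟨W, w, h⟩

lemma stalkTransfer_map_kanGerm {F G : Pre S} (η : F ⟶ G) (W : NisNbhd Y y) {X : Sm S}
    (a : F.obj.obj (op X)) (φ : γ.obj W.V ⟶ γ.obj X) :
    (stalkTransfer γ Y y).map η (kanGerm W (kanMk a φ)) =
      kanGerm W (kanMk (η.hom.app (op X) a) φ) :=
  (stalkFunctor_map_germ ((forgetTr γ ⋙ (additivePresheaf S).ι).map ((transfer γ).map η)) W
    (kanMk a φ : KanValue γ F (γ.obj W.V))).trans
      (congrArg (kanGerm W) (transfer_map_kanMk γ η _ a φ))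

/-- The pairing `F(V) ⊗ Cor(Y_y^h, V) ⟶ (L_tr F)(Y_y^h)`. -/
def corPairing {F : Pre S} {V : Sm S} (s : F.obj.obj (op V)) :
    (corFromHensel γ Y y).obj (γ.obj V) →+ (stalkTransfer γ Y y).obj F :=
  ((stalkFunctor Y y).map (kanTensor F s)).hom

lemma corPairing_corGerm {F : Pre S} {V : Sm S} (s : F.obj.obj (op V)) (W : NisNbhd Y y)
    (φ : γ.obj W.V ⟶ γ.obj V) :
    corPairing s (corGerm W φ) = kanGerm W (kanMk s φ) :=
  stalkFunctor_map_germ (kanTensor F s) W (ULift.up φ)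

lemma corPairing_add {F : Pre S} {V : Sm S} (s t : F.obj.obj (op V))
    (z : (corFromHensel γ Y y).obj (γ.obj V)) :
    corPairing (s + t) z = corPairing s z + corPairing t z := by
  obtain ⟨W, φ, rfl⟩ := exists_corGerm z
  rw [corPairing_corGerm, corPairing_corGerm, corPairing_corGerm, kanMk_add_left, map_add]

lemma corPairing_res {F : Pre S} {V V' : Sm S} (f : V ⟶ V') (s : F.obj.obj (op V'))
    (z : (corFromHensel γ Y y).obj (γ.obj V)) :
    corPairing (F.obj.map f.op s) z = corPairing s ((corFromHensel γ Y y).map (γ.map f) z) := by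
  obtain ⟨W, φ, rfl⟩ := exists_corGerm z
  rw [corPairing_corGerm, corFromHensel_map_corGerm, corPairing_corGerm, kanMk_balance]

lemma stalkTransfer_map_corPairing {F G : Pre S} (η : F ⟶ G) {V : Sm S} (s : F.obj.obj (op V))
    (z : (corFromHensel γ Y y).obj (γ.obj V)) :
    (stalkTransfer γ Y y).map η (corPairing s z) = corPairing (η.hom.app (op V) s) z := by
  obtain ⟨W, φ, rfl⟩ := exists_corGerm z
  rw [corPairing_corGerm, corPairing_corGerm, stalkTransfer_map_kanGerm]

/-- The pairing `F(X_x^h) ⊗ Cor(Y_y^h, X_x^h) ⟶ (L_tr F)(Y_y^h)`. -/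
def stalkPairing {F : Pre S} {X : Sm S} {x : X.left} (ξ : corHensel γ Y y X x) :
    (stalkFunctor X x).obj F.obj ⟶ (stalkTransfer γ Y y).obj F :=
  colimit.desc ((NisNbhd.pro X x).op ⋙ F.obj)
    { pt := (stalkTransfer γ Y y).obj F
      ι :=
        { app := fun A => AddCommGrpCat.ofHom
            (AddMonoidHom.mk' (fun s : F.obj.obj (op A.unop.V) =>
              corPairing s (corHenselπ A.unop ξ)) (fun s t => corPairing_add s t _))
          naturality := fun A B g => by
            ext s
            refine (corPairing_res g.unop.g s _).trans ?_
            rw [corHenselπ_map]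
            rfl } }

lemma stalkPairing_germ {F : Pre S} {X : Sm S} {x : X.left} (ξ : corHensel γ Y y X x)
    (A : NisNbhd X x) (s : F.obj.obj (op A.V)) :
    stalkPairing ξ (germ F.obj A s) = corPairing s (corHenselπ A ξ) :=
  ConcreteCategory.congr_hom
    (colimit.ι_desc (F := (NisNbhd.pro X x).op ⋙ F.obj) _ (op A)) s

lemma stalkPairing_add {F : Pre S} {X : Sm S} {x : X.left} (ξ ζ : corHensel γ Y y X x)
    (z : (stalkFunctor X x).obj F.obj) :
    stalkPairing (ξ + ζ) z = stalkPairing ξ z + stalkPairing ζ z := by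
  obtain ⟨A, s, rfl⟩ := exists_germ z
  rw [stalkPairing_germ, stalkPairing_germ, stalkPairing_germ, map_add, map_add]

lemma stalkTransfer_map_stalkPairing {F G : Pre S} (η : F ⟶ G) {X : Sm S} {x : X.left}
    (ξ : corHensel γ Y y X x) (z : (stalkFunctor X x).obj F.obj) :
    (stalkTransfer γ Y y).map η (stalkPairing ξ z) =
      stalkPairing ξ ((stalkFunctor X x).map η.hom z) := by
  obtain ⟨A, s, rfl⟩ := exists_germ z
  rw [stalkFunctor_map_germ, stalkPairing_germ, stalkPairing_germ, stalkTransfer_map_corPairing]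

/-- The projection formula. -/
lemma stalkPairing_stalkRes {F : Pre S} {X X' : Sm S} (f : X ⟶ X') {x : X.left} {x' : X'.left}
    (h : f.left x = x') (ξ : corHensel γ Y y X x) (z : (stalkFunctor X' x').obj F.obj) :
    stalkPairing ξ (stalkRes F.obj f h z) = stalkPairing (corHenselPush f h ξ) z := by
  obtain ⟨B, s, rfl⟩ := exists_germ z
  rw [stalkPairing_germ, corHenselπ_push, ← corPairing_res, stalkRes_germ']
  exact stalkPairing_germ ξ (NisNbhd.comapObj f h B) _

end

end pairing

end NisTransfer
end

noncomputable section

namespace NisTransfer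

variable {S : Scheme.{u}}

/-! ### Condition (NL) and the retraction -/

section retraction

variable {Cor : Type (u + 1)} [Category.{u} Cor] [Preadditive Cor] {γ : Sm S ⥤ Cor}
  {Y : Sm S} {y : Y.left}

open Classical in
/-- The sum `⨁_x Cor(Y_y^h, X_x^h) ⟶ Cor(Y_y^h, X)`. -/
def corHenselSum (X : Sm S) : (DirectSum X.left fun x => corHensel γ Y y X x) →+
    (corFromHensel γ Y y).obj (γ.obj X) :=
  DirectSum.toAddMonoid (fun x : X.left => corHenselTo γ Y y X x)

open Classical in
lemma corHenselSum_of {X : Sm S} (x : X.left) (ξ : corHensel γ Y y X x) :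
    corHenselSum X (DirectSum.of (fun x => corHensel γ Y y X x) x ξ) =
      corHenselTo γ Y y X x ξ :=
  DirectSum.toAddMonoid_of _ _ _

/-- The inverse of the isomorphism of condition (NL). -/
def corDecomp (hNL : ConditionNL γ) (X : Sm S) :
    (corFromHensel γ Y y).obj (γ.obj X) ≃+ DirectSum X.left fun x => corHensel γ Y y X x :=
  (AddEquiv.ofBijective (corHenselSum X) (hNL Y y X)).symm

lemma corHenselSum_decomp (hNL : ConditionNL γ) {X : Sm S}
    (z : (corFromHensel γ Y y).obj (γ.obj X)) : corHenselSum X (corDecomp hNL X z) = z :=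
  (AddEquiv.ofBijective (corHenselSum X) (hNL Y y X)).apply_symm_apply z

open Classical in
/-- The pushforward of formal sums of local correspondences. -/
def corHenselSumPush {X X' : Sm S} (f : X ⟶ X') :
    (DirectSum X.left fun x => corHensel γ Y y X x) →+
      DirectSum X'.left fun x => corHensel γ Y y X' x :=
  DirectSum.toAddMonoid (fun x : X.left =>
    (DirectSum.of (fun x => corHensel γ Y y X' x) (f.left x)).comp
      (corHenselPush f (rfl : f.left x = f.left x)).hom)

open Classical in
lemma corHenselSumPush_of {X X' : Sm S} (f : X ⟶ X') (x : X.left) (ξ : corHensel γ Y y X x) :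
    corHenselSumPush f (DirectSum.of (fun x => corHensel γ Y y X x) x ξ) =
      DirectSum.of (fun x => corHensel γ Y y X' x) (f.left x) (corHenselPush f rfl ξ) :=
  DirectSum.toAddMonoid_of _ _ _

lemma corHenselSum_push {X X' : Sm S} (f : X ⟶ X')
    (ξ : DirectSum X.left fun x => corHensel γ Y y X x) :
    corHenselSum X' (corHenselSumPush f ξ) =
      (corFromHensel γ Y y).map (γ.map f) (corHenselSum X ξ) := by
  classical
  refine DFunLike.congr_fun (f := (corHenselSum X').comp (corHenselSumPush f))
    (g := ((corFromHensel γ Y y).map (γ.map f)).hom.comp (corHenselSum X)) ?_ ξ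
  refine DirectSum.addHom_ext fun x ξ => ?_
  refine (congrArg (corHenselSum X') (corHenselSumPush_of f x ξ)).trans ?_
  refine (corHenselSum_of _ _).trans ((corHenselTo_push f rfl ξ).trans ?_)
  exact congrArg ((corFromHensel γ Y y).map (γ.map f)) (corHenselSum_of x ξ).symm

/-- The sum map of (NL) is natural in `X` and injective, so its inverse is natural too. -/
lemma corDecomp_map (hNL : ConditionNL γ) {X X' : Sm S} (f : X ⟶ X')
    (z : (corFromHensel γ Y y).obj (γ.obj X)) :
    corDecomp hNL X' ((corFromHensel γ Y y).map (γ.map f) z) =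
      corHenselSumPush f (corDecomp hNL X z) := by
  apply (hNL Y y X').1
  refine (corHenselSum_decomp hNL _).trans ?_
  refine .trans ?_ (corHenselSum_push f _).symm
  rw [corHenselSum_decomp]

variable [PreservesFiniteCoproducts γ]

open Classical in
/-- The pairing of a family of germs with a formal sum of local correspondences. -/
def sumPairing {F : Pre S} {X : Sm S} (a : (godementObj F.obj).obj (op X)) :
    (DirectSum X.left fun x => corHensel γ Y y X x) →+ (stalkTransfer γ Y y).obj F :=
  DirectSum.toAddMonoid (fun x : X.left =>
    AddMonoidHom.mk' (fun ξ => stalkPairing ξ (a x)) (fun ξ ζ => stalkPairing_add ξ ζ (a x)))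

open Classical in
lemma sumPairing_of {F : Pre S} {X : Sm S} (a : (godementObj F.obj).obj (op X)) (x : X.left)
    (ξ : corHensel γ Y y X x) :
    sumPairing a (DirectSum.of (fun x => corHensel γ Y y X x) x ξ) = stalkPairing ξ (a x) :=
  DirectSum.toAddMonoid_of _ _ _

lemma sumPairing_add {F : Pre S} {X : Sm S} (a b : (godementObj F.obj).obj (op X))
    (ξ : DirectSum X.left fun x => corHensel γ Y y X x) :
    sumPairing (a + b) ξ = sumPairing a ξ + sumPairing b ξ := by
  classical
  refine DFunLike.congr_fun (f := sumPairing (a + b))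
    (g := sumPairing a + sumPairing b) ?_ ξ
  refine DirectSum.addHom_ext fun x ξ => ?_
  rw [AddMonoidHom.add_apply, sumPairing_of, sumPairing_of, sumPairing_of]
  exact map_add (stalkPairing ξ).hom (a x) (b x)

/-- The projection formula at each point `x`. The pushforward collects the contributions of all `x`
with the same image `f(x)`. -/
lemma sumPairing_res {F : Pre S} {X X' : Sm S} (f : X ⟶ X')
    (a : (godementObj F.obj).obj (op X'))
    (ξ : DirectSum X.left fun x => corHensel γ Y y X x) :
    sumPairing ((godementObj F.obj).map f.op a) ξ = sumPairing a (corHenselSumPush f ξ) := by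
  classical
  refine DFunLike.congr_fun (f := sumPairing ((godementObj F.obj).map f.op a))
    (g := (sumPairing a).comp (corHenselSumPush f)) ?_ ξ
  refine DirectSum.addHom_ext fun x ξ => ?_
  rw [AddMonoidHom.comp_apply, corHenselSumPush_of, sumPairing_of, sumPairing_of]
  exact stalkPairing_stalkRes f rfl ξ (a (f.left x))

lemma stalkTransfer_map_sumPairing {F G : Pre S} (η : F ⟶ G) {X : Sm S}
    (a : (godementObj F.obj).obj (op X)) (ξ : DirectSum X.left fun x => corHensel γ Y y X x) :
    (stalkTransfer γ Y y).map η (sumPairing a ξ) =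
      sumPairing (((godement S).map η).hom.app (op X) a) ξ := by
  classical
  refine DFunLike.congr_fun (f := ((stalkTransfer γ Y y).map η).hom.comp (sumPairing a))
    (g := sumPairing (((godement S).map η).hom.app (op X) a)) ?_ ξ
  refine DirectSum.addHom_ext fun x ξ => ?_
  refine (congrArg ((stalkTransfer γ Y y).map η) (sumPairing_of a x ξ)).trans ?_
  exact (stalkTransfer_map_stalkPairing η ξ (a x)).trans
    (sumPairing_of (F := G) ((godementPsh.map η.hom).app (op X) a) x ξ).symm

/-- For germs of one global section `s`, pairing with `ξ_x` only sees the image of `ξ_x` in `Cor(U,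
X)`, so the local terms add up to `s ⊗ ∑ ξ_x`. -/
lemma sumPairing_toGodement {F : Pre S} {X : Sm S} (s : F.obj.obj (op X))
    (ξ : DirectSum X.left fun x => corHensel γ Y y X x) :
    sumPairing ((toGodement F.obj).app (op X) s) ξ = corPairing s (corHenselSum X ξ) := by
  classical
  refine DFunLike.congr_fun (f := sumPairing ((toGodement F.obj).app (op X) s))
    (g := (corPairing s).comp (corHenselSum X)) ?_ ξ
  refine DirectSum.addHom_ext fun x ξ => ?_
  rw [sumPairing_of, AddMonoidHom.comp_apply, corHenselSum_of]
  exact stalkPairing_germ ξ (NisNbhd.self X x) s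

variable (hNL : ConditionNL γ)

/-- The components of the retraction. -/
def retractionApp (F : Pre S) (W : NisNbhd Y y) :
    KanValue γ ((godement S).obj F) (γ.obj W.V) →+ (stalkTransfer γ Y y).obj F :=
  kanLift (fun X a φ => sumPairing (F := F) a (corDecomp hNL X (corGerm W φ)))
    (fun X a b φ => sumPairing_add a b _)
    (fun X a φ ψ => by rw [corGerm_add, map_add, map_add])
    -- The balance relation: naturality of the (NL) decomposition turns `φ ≫ γ.map f` into a
    -- pushed-forward sum, to which the projection formula applies.
    (fun X X' f a φ => by
      rw [← corFromHensel_map_corGerm, corDecomp_map]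
      exact sumPairing_res f a _)

lemma retractionApp_mk (F : Pre S) (W : NisNbhd Y y) {X : Sm S}
    (a : (godementObj F.obj).obj (op X)) (φ : γ.obj W.V ⟶ γ.obj X) :
    retractionApp hNL F W (kanMk (F := (godement S).obj F) a φ) =
      sumPairing a (corDecomp hNL X (corGerm W φ)) :=
  kanLift_mk _ _ _ _ _ _

/-- The retraction as a cocone. -/
def retractionCocone (F : Pre S) :
    Cocone ((NisNbhd.pro Y y).op ⋙
      (forgetTr γ ⋙ (additivePresheaf S).ι).obj ((transfer γ).obj ((godement S).obj F))) where
  pt := (stalkTransfer γ Y y).obj F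
  ι :=
    { app := fun W => AddCommGrpCat.ofHom (retractionApp hNL F W.unop)
      naturality := fun W W' g => by
        ext1
        refine kan_hom_ext fun X a φ => ?_
        change retractionApp hNL F W'.unop
          (kanMap γ ((godement S).obj F) (γ.map g.unop.g) (kanMk a φ)) =
            retractionApp hNL F W.unop (kanMk a φ)
        refine (congrArg (retractionApp hNL F W'.unop)
          (kanMap_mk γ _ (γ.map g.unop.g) a φ)).trans ?_
        refine (retractionApp_mk hNL F W'.unop a _).trans ?_
        refine .trans ?_ (retractionApp_mk hNL F W.unop a _).symm
        exact congrArg (fun z => sumPairing a (corDecomp hNL X z)) (corGerm_res g.unop φ) }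

variable (Y y) in
/-- The components of the retraction. -/
def retractionHom (F : Pre S) :
    (stalkTransfer γ Y y).obj ((godement S).obj F) ⟶ (stalkTransfer γ Y y).obj F :=
  colimit.desc _ (retractionCocone hNL F)

lemma retractionHom_kanGerm (F : Pre S) (W : NisNbhd Y y) {X : Sm S}
    (a : (godementObj F.obj).obj (op X)) (φ : γ.obj W.V ⟶ γ.obj X) :
    retractionHom Y y hNL F (kanGerm W (kanMk (F := (godement S).obj F) a φ)) =
      sumPairing a (corDecomp hNL X (corGerm W φ)) :=
  (ConcreteCategory.congr_hom (colimit.ι_desc (retractionCocone hNL F) (op W)) _).trans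
    (retractionApp_mk hNL F W a φ)

lemma stalkTransfer_hom_ext {F : Pre S} {A : AddCommGrpCat.{u + 1}}
    {f g : (stalkTransfer γ Y y).obj F ⟶ A}
    (h : ∀ (W : NisNbhd Y y) (X : Sm S) (a : F.obj.obj (op X)) (φ : γ.obj W.V ⟶ γ.obj X),
      f (kanGerm W (kanMk a φ)) = g (kanGerm W (kanMk a φ))) : f = g := by
  ext z
  obtain ⟨W, w, rfl⟩ := exists_kanGerm z
  exact DFunLike.congr_fun (kan_hom_ext (f := f.hom.comp (kanGerm W))
    (g := g.hom.comp (kanGerm W)) (h W)) w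

lemma retractionHom_naturality {F G : Pre S} (η : F ⟶ G) :
    (stalkTransfer γ Y y).map ((godement S).map η) ≫ retractionHom Y y hNL G =
      retractionHom Y y hNL F ≫ (stalkTransfer γ Y y).map η := by
  refine stalkTransfer_hom_ext fun W X a φ => ?_
  let a' : (godementObj F.obj).obj (op X) := a
  let b : (godementObj G.obj).obj (op X) := (godementPsh.map η.hom).app (op X) a'
  have h₁ : (stalkTransfer γ Y y).map ((godement S).map η) (kanGerm W (kanMk a φ)) =
      kanGerm W (kanMk (F := (godement S).obj G) b φ) :=
    stalkTransfer_map_kanGerm ((godement S).map η) W a φ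
  have h₂ := retractionHom_kanGerm hNL G W b φ
  have h₃ := retractionHom_kanGerm hNL F W a' φ
  have h₄ : (stalkTransfer γ Y y).map η (sumPairing a' (corDecomp hNL X (corGerm W φ))) =
      sumPairing b (corDecomp hNL X (corGerm W φ)) := stalkTransfer_map_sumPairing η a' _
  exact (congrArg (retractionHom Y y hNL G) h₁).trans
    (h₂.trans (h₄.symm.trans (congrArg ((stalkTransfer γ Y y).map η) h₃.symm)))

/-- Under condition (NL), the stalks of `F_tr L_tr F` are retracts of those of `F_tr L_tr` of the
Godement presheaf of `F`. -/
def retraction (Y : Sm S) (y : Y.left) :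
    godement S ⋙ stalkTransfer γ Y y ⟶ stalkTransfer γ Y y where
  app F := retractionHom Y y hNL F
  naturality _ _ η := retractionHom_naturality hNL η

/-- On `s ⊗ φ` the composite is `∑ s ⊗ φ_x = s ⊗ φ`, because the parts `φ_x` sum to `φ`. -/
lemma unit_retraction (Y : Sm S) (y : Y.left) :
    Functor.whiskerRight (godementUnit S) (stalkTransfer γ Y y) ≫ retraction hNL Y y =
      𝟙 (stalkTransfer γ Y y) := by
  ext1
  funext F
  refine stalkTransfer_hom_ext fun W X s φ => ?_
  refine (congrArg (retractionHom Y y hNL F)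
    (stalkTransfer_map_kanGerm ((godementUnit S).app F) W s φ)).trans ?_
  refine (retractionHom_kanGerm hNL F W _ φ).trans ?_
  refine (sumPairing_toGodement s _).trans ?_
  rw [corHenselSum_decomp]
  exact corPairing_corGerm s W φ

end retraction

end NisTransfer
end

noncomputable section

namespace NisTransfer

variable {S : Scheme.{u}}

/-! ### Enough projectives in the category of additive presheaves -/

section projectives

variable (S) in
/-- The extensive topology, whose sheaves are the additive presheaves. -/
abbrev extTopology : GrothendieckTopology (Sm S) := extensiveTopology (Sm S)

/-- The integers, in the universe of the coefficients. -/
abbrev ulintAb : AddCommGrpCat.{u + 1} := AddCommGrpCat.of (ULift.{u + 1} ℤ)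

/-- The morphism from the integers determined by an element. -/
def ulintAb.desc {A : AddCommGrpCat.{u + 1}} (a : A) : ulintAb.{u} ⟶ A :=
  AddCommGrpCat.ofHom ((zmultiplesHom A a).comp (AddEquiv.ulift.toAddMonoidHom))

lemma ulintAb.desc_one {A : AddCommGrpCat.{u + 1}} (a : A) :
    ulintAb.desc a (ULift.up 1) = a :=
  one_zsmul a

lemma ulintAb.hom_ext {A : AddCommGrpCat.{u + 1}} {f g : ulintAb.{u} ⟶ A}
    (h : f (ULift.up 1) = g (ULift.up 1)) : f = g := by
  ext ⟨n⟩
  have hn : (ULift.up n : ULift.{u + 1} ℤ) = n • ULift.up 1 := by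
    ext; simp
  exact (congrArg f hn).trans ((map_zsmul f.hom n _).trans ((congrArg (n • ·) h).trans
    ((map_zsmul g.hom n _).symm.trans (congrArg g hn.symm))))

/-- The additive presheaf freely generated by a section over `X`. -/
def freeAdditive (X : Sm S) : Pre S where
  obj := sheafify (extTopology S) (Presheaf.freeYoneda X ulintAb.{u})
  property := (Presheaf.isSheaf_iff_preservesFiniteProducts _).1
    ((presheafToSheaf (extTopology S) _).obj _).property

/-- The generating section. -/
def freeAdditiveOne (X : Sm S) : (freeAdditive X).obj.obj (op X) :=
  (Presheaf.freeYonedaHomEquiv (toSheafify (extTopology S) (Presheaf.freeYoneda X ulintAb.{u})))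
    (ULift.up 1)

lemma Pre.isSheaf (F : Pre S) : Presheaf.IsSheaf (extTopology S) F.obj :=
  (Presheaf.isSheaf_iff_preservesFiniteProducts _).2 F.property

/-- The morphism determined by a section over `X`. -/
def freeAdditiveDesc {X : Sm S} {F : Pre S} (s : F.obj.obj (op X)) : freeAdditive X ⟶ F :=
  ObjectProperty.homMk (sheafifyLift (extTopology S)
    (Presheaf.freeYonedaHomEquiv.symm (ulintAb.desc s)) F.isSheaf)

lemma freeAdditiveDesc_one {X : Sm S} {F : Pre S} (s : F.obj.obj (op X)) :
    (freeAdditiveDesc s).hom.app (op X) (freeAdditiveOne X) = s := by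
  have h := Presheaf.freeYonedaHomEquiv_comp
    (toSheafify (extTopology S) (Presheaf.freeYoneda X ulintAb.{u}))
    (sheafifyLift (extTopology S) (Presheaf.freeYonedaHomEquiv.symm (ulintAb.desc s)) F.isSheaf)
  rw [toSheafify_sheafifyLift, Equiv.apply_symm_apply] at h
  exact (ConcreteCategory.congr_hom h.symm (ULift.up 1)).trans (ulintAb.desc_one s)

lemma freeAdditive_hom_ext {X : Sm S} {F : Pre S} {f g : freeAdditive X ⟶ F}
    (h₀ : f.hom.app (op X) (freeAdditiveOne X) = g.hom.app (op X) (freeAdditiveOne X)) :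
    f = g := by
  apply ObjectProperty.hom_ext
  refine sheafify_hom_ext _ _ _ F.isSheaf ?_
  apply Presheaf.freeYonedaHomEquiv.injective
  have h (k : freeAdditive X ⟶ F) := Presheaf.freeYonedaHomEquiv_comp
    (toSheafify (extTopology S) (Presheaf.freeYoneda X ulintAb.{u})) k.hom
  exact (h f).trans ((ulintAb.hom_ext h₀).trans (h g).symm)

/-- Cokernels in `Pre S` are computed sectionwise. This is what makes the free objects `freeAdditive
X` projective. -/
lemma Pre.surjective_app_of_epi {F G : Pre S} (f : F ⟶ G) [Epi f] (X : Sm S) :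
    Function.Surjective (f.hom.app (op X)) := by
  have : Epi ((additivePresheaf S).ι.map f) := inferInstance
  have : Epi (((additivePresheaf S).ι.map f).app (op X)) := inferInstance
  exact (AddCommGrpCat.epi_iff_surjective _).1 this

instance (X : Sm S) : Projective (freeAdditive X) where
  factors {F G} f e _ := by
    obtain ⟨s, hs⟩ := Pre.surjective_app_of_epi e X (f.hom.app (op X) (freeAdditiveOne X))
    refine ⟨freeAdditiveDesc s, freeAdditive_hom_ext ?_⟩
    exact (congrArg (e.hom.app (op X)) (freeAdditiveDesc_one s)).trans hs

/-- The projective cover below is indexed by all sections over all `X`, a type in universe `u + 1`.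
-/
instance (J : Type (u + 1)) : (additivePresheaf S).IsClosedUnderColimitsOfShape (Discrete J) where
  colimitsOfShape_le := by
    rintro F ⟨h⟩
    exact preservesFiniteProducts_of_isColimit h.isColimit h.prop_diag_obj

/-- Each section of `F` is the image of the generator of its own summand. -/
instance : EnoughProjectives (Pre S) where
  presentation F := by
    let e : ∐ (fun p : (Σ X : Sm S, F.obj.obj (op X)) => freeAdditive p.1) ⟶ F :=
      Sigma.desc fun p => freeAdditiveDesc p.2
    have : Epi e := Preadditive.epi_of_cancel_zero _ fun {G} g hg => by
      apply ObjectProperty.hom_ext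
      ext X s
      let s' : F.obj.obj (op X.unop) := s
      have h : freeAdditiveDesc s' ≫ g = 0 := by
        have h₁ : Sigma.ι (fun p : (Σ X : Sm S, F.obj.obj (op X)) => freeAdditive p.1)
            ⟨X.unop, s'⟩ ≫ e = freeAdditiveDesc s' :=
          Sigma.ι_desc (fun p : (Σ X : Sm S, F.obj.obj (op X)) => freeAdditiveDesc p.2) _
        rw [← h₁, Category.assoc, hg, comp_zero]
      have h₂ := congrArg (fun t : freeAdditive X.unop ⟶ G =>
        t.hom.app (op X.unop) (freeAdditiveOne X.unop)) h
      exact (congrArg (fun t => g.hom.app X t) (freeAdditiveDesc_one s').symm).trans h₂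
    exact ⟨{ p := _, f := e }⟩

end projectives

end NisTransfer
end

noncomputable section

namespace NisTransfer

/-! ### Kan extensions at objects with a lifting property -/

section kan

variable {C D E : Type*} [Category* C] [Category* D] [Category* E] (L : C ⥤ D) (H : C ⥤ E)

/-- Morphisms out of `L(P)` lift to `C`, uniquely after applying `H`. -/
structure LiftsAt (P : C) : Prop where
  exists_lift {X : C} (f : L.obj P ⟶ L.obj X) : ∃ g : P ⟶ X, L.map g = f
  map_eq {X : C} (g g' : P ⟶ X) (h : L.map g = L.map g') : H.map g = H.map g'

namespace LiftsAt

variable {L H} {P : C} (h : LiftsAt L H P) {Y : D} (e : Y ≅ L.obj P)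

/-- A lift of a morphism. -/
def lift {X : C} (f : L.obj P ⟶ L.obj X) : P ⟶ X := (h.exists_lift f).choose

lemma map_lift {X : C} (f : L.obj P ⟶ L.obj X) : L.map (h.lift f) = f :=
  (h.exists_lift f).choose_spec

/-- The limit cone. -/
def cone : Cone (StructuredArrow.proj Y L ⋙ H) where
  pt := H.obj P
  π :=
    { app := fun g => H.map (h.lift (e.inv ≫ g.hom))
      naturality := fun g g' k => by
        refine (Category.id_comp _).trans ?_
        refine .trans ?_ (H.map_comp _ _)
        refine h.map_eq _ _ ?_
        refine (h.map_lift _).trans (.trans ?_ (L.map_comp _ _).symm)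
        refine .trans ?_ (congrArg (· ≫ _) (h.map_lift _).symm)
        exact (congrArg (e.inv ≫ ·) (StructuredArrow.w k).symm).trans (Category.assoc _ _ _).symm }

lemma cone_app_mk : (h.cone e).π.app (StructuredArrow.mk e.hom) = 𝟙 (H.obj P) :=
  (h.map_eq _ (𝟙 P) ((h.map_lift _).trans ((e.inv_hom_id).trans (L.map_id P).symm))).trans
    (H.map_id P)

/-- The structured arrow `e.hom` is weakly initial, and parallel morphisms out of it agree after
`H`. The limit over the whole comma category is therefore its value there. -/
def isLimitCone : IsLimit (h.cone e) where
  lift s := s.π.app (StructuredArrow.mk e.hom)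
  fac s g := by
    let k : StructuredArrow.mk e.hom ⟶ g := StructuredArrow.homMk (h.lift (e.inv ≫ g.hom)) (by
      change e.hom ≫ L.map _ = _
      rw [h.map_lift, Iso.hom_inv_id_assoc])
    exact s.w k
  uniq s m hm := by
    refine .trans ?_ (hm (StructuredArrow.mk e.hom))
    rw [cone_app_mk]
    exact (Category.comp_id m).symm

lemma hasPointwiseRightKanExtensionAt (h : LiftsAt L H P) (e : Nonempty (Y ≅ L.obj P)) :
    L.HasPointwiseRightKanExtensionAt H Y :=
  ⟨⟨⟨h.cone e.some, h.isLimitCone e.some⟩⟩⟩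

/-- Since a pointwise extension exists, every right Kan extension is pointwise. Its value at `L.obj
P` is then the limit above, and the projection to the identity arrow is `α.app P`. -/
lemma isIso_app (h : LiftsAt L H P) [L.HasPointwiseRightKanExtension H] (G : D ⥤ E) (α : L ⋙ G ⟶ H)
    [G.IsRightKanExtension α] : IsIso (α.app P) := by
  let l := Functor.isPointwiseRightKanExtensionOfIsRightKanExtension G α (L.obj P)
  let e := Iso.refl (L.obj P)
  have h₁ := l.conePointUniqueUpToIso_hom_comp (h.isLimitCone e) (StructuredArrow.mk e.hom)
  have h₂ : (l.conePointUniqueUpToIso (h.isLimitCone e)).hom = G.map (𝟙 _) ≫ α.app P := by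
    refine .trans ?_ h₁
    rw [cone_app_mk]
    exact (Category.comp_id _).symm
  rw [G.map_id] at h₂
  have h₃ : α.app P = (l.conePointUniqueUpToIso (h.isLimitCone e)).hom :=
    (Category.id_comp _).symm.trans h₂.symm
  exact h₃ ▸ (l.conePointUniqueUpToIso (h.isLimitCone e)).isIso_hom

end LiftsAt

end kan

/-! ### Projective resolutions of bounded above complexes -/

section resolutions

variable {C : Type*} [Category* C] [Abelian C]

/-- Dual to injective resolutions of bounded below complexes: pass to the opposite category, where
degrees change sign and the bound `≤ n` becomes `≥ -n`. -/
lemma exists_quasiIso_projective [EnoughProjectives C] (K : CochainComplex C ℤ) (n : ℤ)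
    [K.IsStrictlyLE n] :
    ∃ (P : CochainComplex C ℤ) (p : P ⟶ K), QuasiIso p ∧ (∀ i, Projective (P.X i)) ∧
      P.IsStrictlyLE n := by
  let e := CochainComplex.opEquivalence C
  let K' := e.functor.obj (op K)
  have : K'.IsStrictlyGE (-n) := by
    rw [CochainComplex.isStrictlyGE_iff]
    intro i hi
    exact (K.isZero_of_isStrictlyLE n (-i) (by lia)).op
  obtain ⟨L, q, hq, hL, hL'⟩ :=
    CochainComplex.Plus.modelCategoryQuillen.exists_quasiIso_injective K' (-n)
  let P := (e.inverse.obj L).unop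
  let p : P ⟶ K := (e.unitIso.hom.app (op K) ≫ e.inverse.map q).unop
  refine ⟨P, p, ?_, fun i => ?_, ?_⟩
  · have hp : QuasiIso (e.inverse.map q).unop := ⟨fun j => by
      rw [quasiIsoAt_iff' _ (j - 1) j (j + 1) (by simp) (by simp)]
      -- Degree `j` corresponds to `-j`, with predecessor and successor exchanged.
      have h := (quasiIsoAt_iff' q (-(j + 1)) (-j) (-(j - 1)) (by simp; lia)
        (by simp; lia)).1 inferInstance
      exact ShortComplex.quasiIso_unopMap
        ((HomologicalComplex.shortComplexFunctor' Cᵒᵖ (.up ℤ) (-(j + 1)) (-j) (-(j - 1))).map q)⟩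
    have : IsIso (e.unitIso.hom.app (op K)).unop := inferInstance
    exact (inferInstance : QuasiIso ((e.inverse.map q).unop ≫ (e.unitIso.hom.app (op K)).unop))
  · have : Injective (L.X (-i)) := hL _
    exact inferInstanceAs (Projective (L.X (-i)).unop)
  · rw [CochainComplex.isStrictlyLE_iff]
    intro i hi
    exact (L.isZero_of_isStrictlyGE (-n) (-i) (by lia)).unop

end resolutions

end NisTransfer
end

noncomputable section

namespace NisTransfer

/-! ### Complexes and additive functors -/

section complexes

variable {C D : Type*} [Category* C] [Category* D] [Abelian C] [Abelian D]

lemma quasiIso_iff_acyclic_mappingCone {K L : CochainComplex C ℤ} (f : K ⟶ L) :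
    QuasiIso f ↔ (CochainComplex.mappingCone f).Acyclic := by
  rw [← HomotopyCategory.quotient_obj_mem_subcategoryAcyclic_iff_acyclic,
    ← HomologicalComplex.mem_quasiIso_iff, ← HomotopyCategory.quotient_map_mem_quasiIso_iff,
    HomotopyCategory.quasiIso_eq_trW_subcategoryAcyclic]
  · exact ObjectProperty.trW_iff_of_distinguished _ (CochainComplex.mappingCone.triangleh f)
      (HomotopyCategory.mappingCone_triangleh_distinguished f)

/-- `K`-projectivity is left orthogonality to the acyclic complexes in the homotopy category, and
such a subcategory is closed under cones. -/
lemma isKProjective_mappingCone {K L : CochainComplex C ℤ} (f : K ⟶ L) [K.IsKProjective]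
    [L.IsKProjective] : (CochainComplex.mappingCone f).IsKProjective := by
  rw [CochainComplex.isKProjective_iff_leftOrthogonal]
  exact ObjectProperty.ext_of_isTriangulatedClosed₃ _ _
    (HomotopyCategory.mappingCone_triangleh_distinguished f)
    (CochainComplex.IsKProjective.leftOrthogonal K)
    (CochainComplex.IsKProjective.leftOrthogonal L)

lemma acyclic_of_homotopy_id_zero {K : CochainComplex C ℤ} (h : Homotopy (𝟙 K) 0) :
    K.Acyclic := by
  intro i
  rw [HomologicalComplex.exactAt_iff_isZero_homology, IsZero.iff_id_eq_zero,
    ← HomologicalComplex.homologyMap_id, h.homologyMap_eq, HomologicalComplex.homologyMap_zero]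

/-- If a natural transformation `G ⋙ R ⟶ R` is left inverse to `R(η)`, where `η : 𝟭 ⟶ G`, then
`R` sends `K`-projective complexes that become acyclic under `G` to acyclic complexes. -/
lemma acyclic_map_of_retraction (G : C ⥤ C) [G.Additive] (η : 𝟭 C ⟶ G) (R : C ⥤ D) [R.Additive]
    (r : G ⋙ R ⟶ R) (hr : Functor.whiskerRight η R ≫ r = 𝟙 R) (K : CochainComplex C ℤ)
    [K.IsKProjective] (hK : ((G.mapHomologicalComplex (.up ℤ)).obj K).Acyclic) :
    ((R.mapHomologicalComplex (.up ℤ)).obj K).Acyclic := by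
  let ηK : K ⟶ (G.mapHomologicalComplex (.up ℤ)).obj K :=
    { f := fun i => η.app (K.X i)
      comm' := fun i j _ => (η.naturality (K.d i j)).symm }
  let rK : (R.mapHomologicalComplex (.up ℤ)).obj ((G.mapHomologicalComplex (.up ℤ)).obj K) ⟶
      (R.mapHomologicalComplex (.up ℤ)).obj K :=
    { f := fun i => r.app (K.X i)
      comm' := fun i j _ => (r.naturality (K.d i j)).symm }
  have h₁ : (R.mapHomologicalComplex (.up ℤ)).map ηK ≫ rK = 𝟙 _ := by
    ext i
    exact congr_app hr (K.X i)
  -- `ηK` goes from a `K`-projective complex to an acyclic one, so it is null-homotopic. Applying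
  -- `R` and composing with `rK` contracts the identity.
  have h₂ := (R.mapHomotopy (CochainComplex.IsKProjective.homotopyZero ηK hK)).compRight rK
  rw [h₁, Functor.map_zero, zero_comp] at h₂
  exact acyclic_of_homotopy_id_zero h₂

variable (N : C ⥤ D) [N.Additive] [PreservesFiniteLimits N] [PreservesFiniteColimits N]

/-- An exact functor commutes with homology. -/
lemma isIso_map_homologyMap_iff {K L : CochainComplex C ℤ} (f : K ⟶ L) (i : ℤ) :
    IsIso (N.map (HomologicalComplex.homologyMap f i)) ↔
      QuasiIsoAt ((N.mapHomologicalComplex (.up ℤ)).map f) i := by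
  rw [quasiIsoAt_iff, ShortComplex.quasiIso_iff]
  let φ := (HomologicalComplex.shortComplexFunctor C (.up ℤ) i).map f
  exact ((MorphismProperty.isomorphisms D).arrow_mk_iso_iff
    (((Functor.mapArrowFunctor _ _).mapIso (ShortComplex.homologyFunctorIso N)).app
      (Arrow.mk φ))).symm

lemma forall_isIso_map_homologyMap_iff {K L : CochainComplex C ℤ} (f : K ⟶ L) :
    (∀ i, IsIso (N.map (HomologicalComplex.homologyMap f i))) ↔
      QuasiIso ((N.mapHomologicalComplex (.up ℤ)).map f) := by
  simp only [isIso_map_homologyMap_iff, quasiIso_iff]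

omit [PreservesFiniteLimits N] [PreservesFiniteColimits N] in
-- Mapping cones commute with every additive functor. No exactness may be used here, since the
-- criterion is applied to stalks of the transfer functor.
lemma quasiIso_map_iff_acyclic {K L : CochainComplex C ℤ} (f : K ⟶ L) :
    QuasiIso ((N.mapHomologicalComplex (.up ℤ)).map f) ↔
      ((N.mapHomologicalComplex (.up ℤ)).obj (CochainComplex.mappingCone f)).Acyclic := by
  rw [quasiIso_iff_acyclic_mappingCone]
  let e := CochainComplex.mappingCone.mapHomologicalComplexIso f N
  exact ⟨fun h i => (h i).of_iso e.symm, fun h i => (h i).of_iso e⟩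

end complexes

/-! ### Total left derived functors on bounded above derived categories -/

section derived

variable {C D : Type*} [Category* C] [Category* D] [Abelian C] [Abelian D]
  [HasDerivedCategory.{w₁} C] [HasDerivedCategory.{w₂} D]

lemma Q_map_surjective (K L : CochainComplex C ℤ) [K.IsKProjective]
    (f : DerivedCategory.Q.obj K ⟶ DerivedCategory.Q.obj L) :
    ∃ g : K ⟶ L, DerivedCategory.Q.map g = f := by
  obtain ⟨g, hg⟩ := (CochainComplex.IsKProjective.Qh_map_bijective K
    ((HomotopyCategory.quotient _ _).obj L)).2
      ((DerivedCategory.quotientCompQhIso C).hom.app K ≫ f ≫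
        (DerivedCategory.quotientCompQhIso C).inv.app L)
  obtain ⟨g, rfl⟩ := (HomotopyCategory.quotient _ _).map_surjective g
  refine ⟨g, ?_⟩
  have h := DerivedCategory.quotientCompQhIso_hom_naturality g
  rw [hg] at h
  rw [← cancel_epi ((DerivedCategory.quotientCompQhIso C).hom.app K), ← h]
  simp

lemma nonempty_homotopy_of_Q_map_eq {K L : CochainComplex C ℤ} [K.IsKProjective] (f g : K ⟶ L)
    (h : DerivedCategory.Q.map f = DerivedCategory.Q.map g) : Nonempty (Homotopy f g) := by
  refine ⟨HomotopyCategory.homotopyOfEq _ _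
    ((CochainComplex.IsKProjective.Qh_map_bijective K _).1 ?_)⟩
  have hf := DerivedCategory.quotientCompQhIso_hom_naturality f
  have hg := DerivedCategory.quotientCompQhIso_hom_naturality g
  rw [h] at hf
  exact (cancel_mono _).1 (hf.trans hg.symm)

/-- Morphisms out of a `K`-projective complex in the derived category are homotopy classes of chain
maps. Lifts are unique only up to homotopy, but `F` preserves homotopies and the localization
identifies homotopic maps. -/
lemma liftsAt_QMinus (F : C ⥤ D) [F.Additive] (P : CompMinus C) [P.obj.IsKProjective] :
    LiftsAt (QMinus C) (mapCompMinus F ⋙ QMinus D) P where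
  exists_lift {X} f := by
    obtain ⟨g, hg⟩ := Q_map_surjective P.obj X.obj f.hom
    exact ⟨ObjectProperty.homMk g, ObjectProperty.hom_ext _ hg⟩
  map_eq {X} g g' h := by
    obtain ⟨h'⟩ := nonempty_homotopy_of_Q_map_eq g.hom g'.hom
      (congrArg (fun k => k.hom) h)
    exact ObjectProperty.hom_ext _
      (DerivedCategory.Q_map_eq_of_homotopy D (F.mapHomotopy h'))

lemma exists_iso_QMinus [EnoughProjectives C] (Y : DerivedCategory.Minus C) :
    ∃ P : CompMinus C, P.obj.IsKProjective ∧ Nonempty (Y ≅ (QMinus C).obj P) := by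
  obtain ⟨Y, n, hY⟩ := Y
  obtain ⟨K, e, hK⟩ := hY
  obtain ⟨P, p, hp, hP, hP'⟩ := exists_quasiIso_projective K n
  have : IsIso (DerivedCategory.Q.map p) := (DerivedCategory.isIso_Q_map_iff_quasiIso C p).2 hp
  exact ⟨⟨P, n, hP'⟩, CochainComplex.isKProjective_of_projective P n,
    ⟨ObjectProperty.isoMk _ (e ≪≫ (asIso (DerivedCategory.Q.map p)).symm)⟩⟩

variable [EnoughProjectives C] (F : C ⥤ D) [F.Additive]

instance hasPointwiseRightKanExtension_QMinus :
    (QMinus C).HasPointwiseRightKanExtension (mapCompMinus F ⋙ QMinus D) := fun Y => by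
  obtain ⟨P, hP, e⟩ := exists_iso_QMinus Y
  exact (liftsAt_QMinus F P).hasPointwiseRightKanExtensionAt e

lemma exists_isTotalLeftDerived : ∃ LL α, IsTotalLeftDerived F LL α :=
  ⟨_, (QMinus C).pointwiseRightKanExtensionCounit (mapCompMinus F ⋙ QMinus D),
    inferInstanceAs (Functor.IsRightKanExtension _ _)⟩

variable {F} {LL : DerivedCategory.Minus C ⥤ DerivedCategory.Minus D}
  {α : QMinus C ⋙ LL ⟶ mapCompMinus F ⋙ QMinus D}

lemma IsTotalLeftDerived.isIso_app (h : IsTotalLeftDerived F LL α) (P : CompMinus C)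
    [P.obj.IsKProjective] : IsIso (α.app P) := by
  have : LL.IsRightKanExtension α := h
  exact (liftsAt_QMinus F P).isIso_app LL α

end derived

end NisTransfer
end

noncomputable section

namespace NisTransfer

variable {S : Scheme.{u}}

/-! ### The transfer functor on complexes with acyclic stalks -/

/-- The stalk of an additive presheaf. -/
abbrev stalkPre (X : Sm S) (x : X.left) : Pre S ⥤ AddCommGrpCat.{u + 1} :=
  (additivePresheaf S).ι ⋙ stalkFunctor X x

section transfer

variable {Cor : Type (u + 1)} [Category.{u} Cor] [Preadditive Cor] {γ : Sm S ⥤ Cor}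
  [PreservesFiniteCoproducts γ]

lemma acyclic_godement (K : CochainComplex (Pre S) ℤ)
    (hK : ∀ X x, (((stalkPre X x).mapHomologicalComplex (.up ℤ)).obj K).Acyclic) :
    (((godement S).mapHomologicalComplex (.up ℤ)).obj K).Acyclic :=
  fun i => exact_map_godement (K.sc i) fun X x => hK X x i

lemma acyclic_stalkTransfer (hNL : ConditionNL γ) (K : CochainComplex (Pre S) ℤ) [K.IsKProjective]
    (hK : ∀ X x, (((stalkPre X x).mapHomologicalComplex (.up ℤ)).obj K).Acyclic)
    (Y : Sm S) (y : Y.left) :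
    (((stalkTransfer γ Y y).mapHomologicalComplex (.up ℤ)).obj K).Acyclic :=
  acyclic_map_of_retraction (godement S) (godementUnit S) (stalkTransfer γ Y y)
    (retraction hNL Y y) (unit_retraction hNL Y y) K (acyclic_godement K hK)

/-- The mapping cone of `f` is again `K`-projective and has acyclic stalks, so the statement for
acyclic complexes applies to it. -/
lemma quasiIso_stalkTransfer (hNL : ConditionNL γ) {K L : CochainComplex (Pre S) ℤ}
    [K.IsKProjective] [L.IsKProjective] (f : K ⟶ L)
    (hf : ∀ X x, QuasiIso (((stalkPre X x).mapHomologicalComplex (.up ℤ)).map f))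
    (Y : Sm S) (y : Y.left) :
    QuasiIso (((stalkTransfer γ Y y).mapHomologicalComplex (.up ℤ)).map f) := by
  have := isKProjective_mappingCone f
  exact (quasiIso_map_iff_acyclic _ f).2 (acyclic_stalkTransfer hNL _
    (fun X x => (quasiIso_map_iff_acyclic _ f).1 (hf X x)) Y y)

lemma isIso_sheafify_iff_stalk {F G : (Sm S)ᵒᵖ ⥤ AddCommGrpCat.{u + 1}} (η : F ⟶ G) :
    IsIso ((presheafToSheaf (nisTopology S) AddCommGrpCat.{u + 1}).map η) ↔
      ∀ (X : Sm S) (x : X.left), IsIso ((stalkFunctor X x).map η) := by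
  rw [isIso_sheafify_iff_stalk_bijective]
  exact forall₂_congr fun X x => (ConcreteCategory.isIso_iff_bijective _).symm

/-- Isomorphisms of associated sheaves are tested on stalks, and the exact stalk functors commute
with cohomology. -/
lemma isNisQuasiIso_QMinus_map_iff [HasDerivedCategory.{w₁} (Pre S)] {P P' : CompMinus (Pre S)}
    (f : P ⟶ P') :
    IsNisQuasiIso ((QMinus (Pre S)).map f) ↔
      ∀ X x, QuasiIso (((stalkPre X x).mapHomologicalComplex (.up ℤ)).map f.hom) := by
  simp only [← forall_isIso_map_homologyMap_iff]
  refine .trans (forall_congr' fun i => ?_)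
    (show (∀ i X x, IsIso _) ↔ _ from ⟨fun h X x i => h i X x, fun h i X x => h X x i⟩)
  refine .trans ?_ (isIso_sheafify_iff_stalk
    ((additivePresheaf S).ι.map (HomologicalComplex.homologyMap f.hom i)))
  exact NatIso.isIso_map_iff (Functor.isoWhiskerRight
    (DerivedCategory.homologyFunctorFactors (Pre S) i) ((additivePresheaf S).ι ⋙
      presheafToSheaf (nisTopology S) AddCommGrpCat.{u + 1})) f.hom

lemma isNisQuasiIsoTr_QMinus_map_iff [HasDerivedCategory.{w₂} (PreTr Cor)]
    {P P' : CompMinus (PreTr Cor)} (f : P ⟶ P') :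
    IsNisQuasiIsoTr γ ((QMinus (PreTr Cor)).map f) ↔
      ∀ X x, QuasiIso (((stalkTr γ X x).mapHomologicalComplex (.up ℤ)).map f.hom) := by
  simp only [← forall_isIso_map_homologyMap_iff]
  refine .trans (forall_congr' fun i => ?_)
    (show (∀ i X x, IsIso _) ↔ _ from ⟨fun h X x i => h i X x, fun h i X x => h X x i⟩)
  refine .trans ?_ (isIso_sheafify_iff_stalk
    ((forgetTr γ ⋙ (additivePresheaf S).ι).map (HomologicalComplex.homologyMap f.hom i)))
  exact NatIso.isIso_map_iff (Functor.isoWhiskerRight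
    (DerivedCategory.homologyFunctorFactors (PreTr Cor) i)
    ((forgetTr γ ⋙ (additivePresheaf S).ι) ⋙
      presheafToSheaf (nisTopology S) AddCommGrpCat.{u + 1})) f.hom

variable [HasDerivedCategory.{w₁} (Pre S)] [HasDerivedCategory.{w₂} (PreTr Cor)]

lemma isNisQuasiIsoTr_QMinus_map (hNL : ConditionNL γ) {P P' : CompMinus (Pre S)}
    [P.obj.IsKProjective] [P'.obj.IsKProjective] (f : P ⟶ P')
    (hf : IsNisQuasiIso ((QMinus (Pre S)).map f)) :
    IsNisQuasiIsoTr γ ((mapCompMinus (transfer γ) ⋙ QMinus (PreTr Cor)).map f) :=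
  (isNisQuasiIsoTr_QMinus_map_iff _).2 fun Y y =>
    quasiIso_stalkTransfer hNL f.hom ((isNisQuasiIso_QMinus_map_iff f).1 hf) Y y

lemma isNisQuasiIso_iff_of_arrow_iso {A B A' B' : DerivedCategory.Minus (Pre S)} {w : A ⟶ B}
    {w' : A' ⟶ B'} (e : Arrow.mk w ≅ Arrow.mk w') : IsNisQuasiIso w ↔ IsNisQuasiIso w' :=
  forall_congr' fun i => (MorphismProperty.isomorphisms _).arrow_mk_iso_iff
    ((nisCohomology S i).mapArrow.mapIso e)

omit [HasDerivedCategory.{w₁} (Pre S)] in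
lemma isNisQuasiIsoTr_iff_of_arrow_iso {A B A' B' : DerivedCategory.Minus (PreTr Cor)}
    {w : A ⟶ B} {w' : A' ⟶ B'} (e : Arrow.mk w ≅ Arrow.mk w') :
    IsNisQuasiIsoTr γ w ↔ IsNisQuasiIsoTr γ w' :=
  forall_congr' fun i => (MorphismProperty.isomorphisms _).arrow_mk_iso_iff
    ((nisCohomologyTr γ i).mapArrow.mapIso e)

/-- Every morphism of the bounded above derived category is represented by a morphism of
bounded above complexes of projectives. -/
lemma exists_arrow_iso_QMinus_map {C : Type*} [Category* C] [Abelian C] [EnoughProjectives C]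
    [HasDerivedCategory.{w₁} C] {A B : DerivedCategory.Minus C} (w : A ⟶ B) :
    ∃ (P P' : CompMinus C) (f : P ⟶ P'), P.obj.IsKProjective ∧ P'.obj.IsKProjective ∧
      Nonempty (Arrow.mk w ≅ Arrow.mk ((QMinus C).map f)) := by
  obtain ⟨P, hP, ⟨e⟩⟩ := exists_iso_QMinus A
  obtain ⟨P', hP', ⟨e'⟩⟩ := exists_iso_QMinus B
  obtain ⟨f, hf⟩ := (liftsAt_QMinus (𝟭 C) P).exists_lift (e.inv ≫ w ≫ e'.hom)
  exact ⟨P, P', f, hP, hP', ⟨Arrow.isoMk e e' (by simp [hf])⟩⟩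

variable {LL : DerivedCategory.Minus (Pre S) ⥤ DerivedCategory.Minus (PreTr Cor)}
  {α : QMinus (Pre S) ⋙ LL ⟶ mapCompMinus (transfer γ) ⋙ QMinus (PreTr Cor)}

/-- Up to isomorphism `w` comes from a chain map `f` between `K`-projective complexes. There `α` is
invertible, so `LL.map w` is isomorphic to the image of `f` under the underived transfer functor. -/
lemma IsTotalLeftDerived.isNisQuasiIsoTr_map (h : IsTotalLeftDerived (transfer γ) LL α)
    (hNL : ConditionNL γ) {A B : DerivedCategory.Minus (Pre S)} (w : A ⟶ B)
    (hw : IsNisQuasiIso w) : IsNisQuasiIsoTr γ (LL.map w) := by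
  obtain ⟨P, P', f, hP, hP', ⟨e⟩⟩ := exists_arrow_iso_QMinus_map w
  have := h.isIso_app P
  have := h.isIso_app P'
  let e' : Arrow.mk (LL.map ((QMinus (Pre S)).map f)) ≅
      Arrow.mk ((mapCompMinus (transfer γ) ⋙ QMinus (PreTr Cor)).map f) :=
    Arrow.isoMk (asIso (α.app P)) (asIso (α.app P')) (α.naturality f).symm
  refine (isNisQuasiIsoTr_iff_of_arrow_iso (LL.mapArrow.mapIso e ≪≫ e')).2 ?_
  exact isNisQuasiIsoTr_QMinus_map hNL f ((isNisQuasiIso_iff_of_arrow_iso e).1 hw)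

/-- `LL` is only known as a Kan extension, with no additivity assumed. Preservation of zero
endomorphisms is transported along the invertible `α` from the additive transfer functor. -/
lemma IsTotalLeftDerived.map_zero (h : IsTotalLeftDerived (transfer γ) LL α)
    (A : DerivedCategory.Minus (Pre S)) : LL.map (0 : A ⟶ A) = 0 := by
  obtain ⟨P, hP, ⟨e⟩⟩ := exists_iso_QMinus A
  have := h.isIso_app P
  have h₀ : (0 : A ⟶ A) = e.hom ≫ (QMinus (Pre S)).map (0 : P ⟶ P) ≫ e.inv := by
    have : (QMinus (Pre S)).map (0 : P ⟶ P) = 0 := ObjectProperty.hom_ext _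
      (DerivedCategory.Q.map_zero _ _)
    rw [this, zero_comp, comp_zero]
  have h₁ : LL.map ((QMinus (Pre S)).map (0 : P ⟶ P)) = 0 := by
    have : (mapCompMinus (transfer γ) ⋙ QMinus (PreTr Cor)).map (0 : P ⟶ P) = 0 :=
      ObjectProperty.hom_ext _ ((congrArg DerivedCategory.Q.map
        (Functor.map_zero ((transfer γ).mapHomologicalComplex (.up ℤ)) _ _)).trans
          (DerivedCategory.Q.map_zero _ _))
    have h₂ := α.naturality (0 : P ⟶ P)
    rw [this, comp_zero] at h₂
    exact (cancel_mono (α.app P)).1 (h₂.trans zero_comp.symm)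
  rw [h₀, LL.map_comp, LL.map_comp, h₁, zero_comp, comp_zero]

instance (i : ℤ) : (nisCohomologyTr γ i).Additive := by
  unfold nisCohomologyTr
  infer_instance

/-- An object is Nisnevich acyclic exactly when its zero endomorphism is a Nisnevich
quasi-isomorphism, and `LL` preserves both zero endomorphisms and Nisnevich quasi-isomorphisms. -/
lemma IsTotalLeftDerived.isNisAcyclicTr_obj (h : IsTotalLeftDerived (transfer γ) LL α)
    (hNL : ConditionNL γ) (A : DerivedCategory.Minus (Pre S)) (hA : IsNisAcyclic A) :
    IsNisAcyclicTr γ (LL.obj A) := fun i => by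
  have h₀ : IsNisQuasiIso (0 : A ⟶ A) := fun i => (hA i).isIso (hA i) _
  have h₁ := h.isNisQuasiIsoTr_map hNL _ h₀ i
  rw [h.map_zero, Functor.map_zero] at h₁
  exact (IsZero.iff_id_eq_zero _).2 ((cancel_mono (0 : (nisCohomologyTr γ i).obj (LL.obj A) ⟶
    (nisCohomologyTr γ i).obj (LL.obj A))).1 (comp_zero.trans comp_zero.symm))

end transfer

end NisTransfer


theorem mainTheorem7
    (S : Scheme.{u}) [IsNoetherian S] [S.IsSeparated]
    {Cor : Type (u + 1)} [Category.{u} Cor] [Preadditive Cor]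
    (γ : NisTransfer.Sm S ⥤ Cor) (hγ : Function.Bijective γ.obj) [PreservesFiniteCoproducts γ]
    [HasDerivedCategory.{w₁} (NisTransfer.Pre S)]
    [HasDerivedCategory.{w₂} (NisTransfer.PreTr Cor)]
    (hNL : NisTransfer.ConditionNL γ) :
    (∃ LL α, NisTransfer.IsTotalLeftDerived (NisTransfer.transfer γ) LL α) ∧
    ∀ LL α, NisTransfer.IsTotalLeftDerived (NisTransfer.transfer γ) LL α →
      (∀ A, NisTransfer.IsNisAcyclic A → NisTransfer.IsNisAcyclicTr γ (LL.obj A)) ∧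
      (∀ {A B : DerivedCategory.Minus (NisTransfer.Pre S)} (w : A ⟶ B),
        NisTransfer.IsNisQuasiIso w → NisTransfer.IsNisQuasiIsoTr γ (LL.map w)) := 
  ⟨NisTransfer.exists_isTotalLeftDerived _, fun _ _ h =>
    ⟨h.isNisAcyclicTr_obj hNL, h.isNisQuasiIsoTr_map hNL⟩⟩
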